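/- Fix $q\in\mathbf{C}$ with $|q|>1$ and $z_0\in\mathbf{C}^*$. Let $\mathcal{R}=\mathrm{Rep}_{\mathbf{C}}(\mathbf{Z})$ be the category whose objects are the pairs $(\mathbf{C}^n,A)$ with $n\ge 0$, $A\in GL_n(\mathbf{C})$, and whose morphisms $(\mathbf{C}^n,A)\to(\mathbf{C}^p,B)$ are the matrices $F\in M_{p,n}(\mathbf{C})$ with $FA=BF$; let $\mathcal{P}^{(0)}$ be the category with the same objects, whose morphisms are the matrices $F\in M_{p,n}(\mathbf{C}(\{z\}))$ with $F(qz)A=BF(z)$, where $\mathbf{C}(\{z\})$ is the field of convergent Laurent series (germs at $0$ of meromorphic functions). Both are tensor categories under $(\mathbf{C}^n,A)\otimes(\mathbf{C}^m,B)=(\mathbf{C}^{nm},A\otimes B)$, $F\otimes G$ the Kronecker product, with unit $(\mathbf{C},1)$. Morphisms of $\mathcal{P}^{(0)}$ are Laurent polynomials in $z$, so that they can be evaluated at $z_0$. Let $\omega$ be the forgetful tensor functor $(\mathbf{C}^n,A)\mapsto\mathbf{C}^n$, $F\mapsto F$ on $\mathcal{R}$ and $\omega^{(0)}_{z_0}$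 the tensor functor $(\mathbf{C}^n,A)\mapsto\mathbf{C}^n$, $F\mapsto F(z_0)$ on $\mathcal{P}^{(0)}$, both with values in finite-dimensional complex vector spaces, and let $\mathrm{Aut}^\otimes$ denote the group of tensor automorphisms. Since $\omega^{(0)}_{z_0}$ restricts to $\omega$ along the embedding $\mathcal{R}\to\mathcal{P}^{(0)}$, there is a restriction homomorphism $\rho:\mathrm{Aut}^\otimes(\omega^{(0)}_{z_0})\to\mathrm{Aut}^\otimes(\omega)$. Put $\mathbf{Z}^{alg}=\mathrm{Hom}_{grp}(\mathbf{C}^*,\mathbf{C}^*)\times\mathbf{C}$. For $A\in GL_n(\mathbf{C})$ with multiplicative Dunford decomposition $A=A_sA_u$ ($A_s=Q\,\mathrm{diag}(c_1,\dots,c_n)\,Q^{-1}$ semisimple, $A_u$ unipotent, $A_sA_u=A_uA_s$) and $(\gamma,\lambda)\in\mathbf{Z}^{alg}$, put $A^{(\gamma,\lambda)}=\gamma(A_s)A_u^{\lambda}$, where $\gamma(A_s)=Q\,\mathrm{diag}(\gamma(c_1),\dots,\gamma(c_n))\,Q^{-1}$ and $A_u^\lambda=\sum_{k\ge0}\binom{\lambda}{k}(A_u-I_n)^k$.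 Then $A^{(\gamma,\lambda)}$ is well defined, and $(\gamma,\lambda)\mapsto\big((\mathbf{C}^n,A)\mapsto A^{(\gamma,\lambda)}\big)$ is an isomorphism of groups $\mathbf{Z}^{alg}\to\mathrm{Aut}^\otimes(\omega)$; the restriction $\rho$ is injective; and, under this identification, its image is $$\mathrm{Aut}^\otimes(\omega^{(0)}_{z_0})=\{(\gamma,\lambda)\in\mathrm{Hom}_{grp}(\mathbf{C}^*,\mathbf{C}^*)\times\mathbf{C} : \gamma(q)=1\}.$$ Equivalently, there is an isomorphism of groups $\mathrm{Hom}_{grp}(\mathbf{C}^*/q^{\mathbf{Z}},\mathbf{C}^*)\times\mathbf{C}\to\mathrm{Aut}^\otimes(\omega^{(0)}_{z_0})$ which, composed with $\rho$, sends $(\chi,\lambda)$ to the element $(\chi\circ\pi,\lambda)$ of $\mathbf{Z}^{alg}$, where $\pi:\mathbf{C}^*\to\mathbf{C}^*/q^{\mathbf{Z}}$ is the projection. -/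

import Mathlib

open CategoryTheory MonoidalCategory

noncomputable section

namespace QDiff

/-- The bijection `(i₁, i₂) ↦ i₁ + n₁ i₂` (indices starting at `0`) that identifies
`K^{n₁} ⊗ K^{n₂}` with `K^{n₁ n₂}`. -/
def pairEquiv (n₁ n₂ : ℕ) : Fin n₁ × Fin n₂ ≃ Fin (n₁ * n₂) :=
  ((Equiv.prodComm _ _).trans finProdFinEquiv).trans (finCongr (Nat.mul_comm n₂ n₁))

/-- The Kronecker product of matrices, with rows and columns numbered through `pairEquiv`. -/
def kron {R : Type} [CommRing R] {p₁ n₁ p₂ n₂ : ℕ} (F : Matrix (Fin p₁) (Fin n₁) R)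
    (G : Matrix (Fin p₂) (Fin n₂) R) : Matrix (Fin (p₁ * p₂)) (Fin (n₁ * n₂)) R :=
  (Matrix.kronecker F G).submatrix (pairEquiv p₁ p₂).symm (pairEquiv n₁ n₂).symm

/-- The matrix of the linear map that sends the basis vector `j` to the basis vector `s j`. -/
def permMat (R : Type) [CommRing R] {n m : ℕ} (s : Fin n ≃ Fin m) :
    Matrix (Fin m) (Fin n) R :=
  (1 : Matrix (Fin m) (Fin m) R).submatrix id s

/-- The bijection of indices underlying `(X ⊗ Y) ⊗ Z ≅ X ⊗ (Y ⊗ Z)`. -/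
def assocEquiv (a b c : ℕ) : Fin (a * b * c) ≃ Fin (a * (b * c)) :=
  (pairEquiv (a * b) c).symm.trans
    ((((pairEquiv a b).symm.prodCongr (Equiv.refl _)).trans (Equiv.prodAssoc _ _ _)).trans
      (((Equiv.refl _).prodCongr (pairEquiv b c)).trans (pairEquiv a (b * c))))

/-- The bijection of indices underlying `1 ⊗ X ≅ X`. -/
def leftEquiv (a : ℕ) : Fin (1 * a) ≃ Fin a :=
  (pairEquiv 1 a).symm.trans (Equiv.uniqueProd (Fin a) (Fin 1))

/-- The bijection of indices underlying `X ⊗ 1 ≅ X`. -/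
def rightEquiv (a : ℕ) : Fin (a * 1) ≃ Fin a :=
  (pairEquiv a 1).symm.trans (Equiv.prodUnique (Fin a) (Fin 1))

section Matrices

variable {R : Type} [CommRing R] {R' : Type} [CommRing R']

theorem kron_apply {p₁ n₁ p₂ n₂ : ℕ} (F : Matrix (Fin p₁) (Fin n₁) R)
    (G : Matrix (Fin p₂) (Fin n₂) R) (i : Fin (p₁ * p₂)) (j : Fin (n₁ * n₂)) :
    kron F G i j = F ((pairEquiv p₁ p₂).symm i).1 ((pairEquiv n₁ n₂).symm j).1 *
      G ((pairEquiv p₁ p₂).symm i).2 ((pairEquiv n₁ n₂).symm j).2 := rfl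

theorem kron_mul {p₁ n₁ m₁ p₂ n₂ m₂ : ℕ} (F : Matrix (Fin p₁) (Fin n₁) R)
    (G : Matrix (Fin p₂) (Fin n₂) R) (F' : Matrix (Fin n₁) (Fin m₁) R)
    (G' : Matrix (Fin n₂) (Fin m₂) R) :
    kron F G * kron F' G' = kron (F * F') (G * G') := by
  unfold kron
  rw [Matrix.submatrix_mul_equiv]
  exact congrArg (fun M => Matrix.submatrix M _ _) (Matrix.mul_kronecker_mul F F' G G').symm

theorem kron_one (n₁ n₂ : ℕ) :
    kron (1 : Matrix (Fin n₁) (Fin n₁) R) (1 : Matrix (Fin n₂) (Fin n₂) R) = 1 := by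
  have h : Matrix.kronecker (1 : Matrix (Fin n₁) (Fin n₁) R) (1 : Matrix (Fin n₂) (Fin n₂) R) = 1 :=
    Matrix.one_kronecker_one
  unfold kron
  rw [h, Matrix.submatrix_one_equiv]

theorem kron_map (f : R →+* R') {p₁ n₁ p₂ n₂ : ℕ} (F : Matrix (Fin p₁) (Fin n₁) R)
    (G : Matrix (Fin p₂) (Fin n₂) R) : (kron F G).map f = kron (F.map f) (G.map f) := by
  ext i j
  simp [kron_apply]

theorem permMat_mul {n m l : ℕ} (s : Fin n ≃ Fin m) (M : Matrix (Fin n) (Fin l) R) :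
    permMat R s * M = M.submatrix s.symm id := by
  ext i j
  simp [permMat, Matrix.mul_apply, Matrix.one_apply, ← Equiv.symm_apply_eq]

theorem mul_permMat {n m l : ℕ} (s : Fin n ≃ Fin m) (M : Matrix (Fin l) (Fin m) R) :
    M * permMat R s = M.submatrix id s := by
  ext i j
  simp [permMat, Matrix.mul_apply, Matrix.one_apply]

theorem permMat_map (f : R →+* R') {n m : ℕ} (s : Fin n ≃ Fin m) :
    (permMat R s).map f = permMat R' s := by
  ext i j
  simp [permMat, Matrix.one_apply, apply_ite f]

theorem permMat_mul_permMat {n m l : ℕ} (s : Fin n ≃ Fin m) (t : Fin m ≃ Fin l) :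
    permMat R t * permMat R s = permMat R (s.trans t) := by
  ext i j
  rw [mul_permMat]
  simp [permMat, Matrix.one_apply]

theorem permMat_refl (n : ℕ) : permMat R (Equiv.refl (Fin n)) = 1 := by
  ext i j
  simp [permMat, Matrix.one_apply]

theorem permMat_mul_symm {n m : ℕ} (s : Fin n ≃ Fin m) :
    permMat R s * permMat R s.symm = 1 := by
  rw [permMat_mul_permMat, Equiv.symm_trans_self, permMat_refl]

theorem permMat_symm_mul {n m : ℕ} (s : Fin n ≃ Fin m) :
    permMat R s.symm * permMat R s = 1 := by
  rw [permMat_mul_permMat, Equiv.self_trans_symm, permMat_refl]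

theorem kron_permMat {n m n' m' : ℕ} (s : Fin n ≃ Fin m) (t : Fin n' ≃ Fin m') :
    kron (permMat R s) (permMat R t) =
      permMat R (((pairEquiv n n').symm.trans (s.prodCongr t)).trans (pairEquiv m m')) := by
  ext i j
  obtain ⟨⟨a, b⟩, rfl⟩ := (pairEquiv m m').surjective i
  obtain ⟨⟨c, d⟩, rfl⟩ := (pairEquiv n n').surjective j
  by_cases h : a = s c <;> by_cases h' : b = t d <;>
    simp [kron_apply, permMat, Matrix.one_apply, h, h']

theorem kron_assoc_apply {a b c : ℕ} (L : Matrix (Fin a) (Fin a) R) (M : Matrix (Fin b) (Fin b) R)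
    (N : Matrix (Fin c) (Fin c) R) (i j : Fin (a * b * c)) :
    kron L (kron M N) (assocEquiv a b c i) (assocEquiv a b c j) = kron (kron L M) N i j := by
  simp [kron_apply, assocEquiv, mul_assoc]

theorem kron_left_apply {a : ℕ} (M : Matrix (Fin a) (Fin a) R) (i j : Fin (1 * a)) :
    M (leftEquiv a i) (leftEquiv a j) = kron (1 : Matrix (Fin 1) (Fin 1) R) M i j := by
  simp [kron_apply, leftEquiv, Matrix.one_apply, eq_iff_true_of_subsingleton]

theorem kron_right_apply {a : ℕ} (M : Matrix (Fin a) (Fin a) R) (i j : Fin (a * 1)) :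
    M (rightEquiv a i) (rightEquiv a j) = kron M (1 : Matrix (Fin 1) (Fin 1) R) i j := by
  simp [kron_apply, rightEquiv, Matrix.one_apply, eq_iff_true_of_subsingleton]

end Matrices

/-- An object `(ℂⁿ, A)`, `A ∈ GLₙ(ℂ)`: the system `σ X = A X` with constant coefficients. The
parameters `K` and `σ` only serve to select the morphisms. -/
structure FlatSys (K : Type) [CommRing K] [Algebra ℂ K] (σ : K →+* K) : Type where
  /-- the rank -/
  n : ℕ
  /-- the matrix of the system -/
  A : GL (Fin n) ℂ

namespace FlatSys

variable {K : Type} [CommRing K] [Algebra ℂ K] {σ : K →+* K}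

/-- The matrix of the system, with coefficients in `K`. -/
def mat (X : FlatSys K σ) : Matrix (Fin X.n) (Fin X.n) K :=
  (X.A : Matrix (Fin X.n) (Fin X.n) ℂ).map (algebraMap ℂ K)

/-- A morphism `(ℂⁿ, A) → (ℂᵖ, B)` with coefficients in `K`:
a matrix `F ∈ M_{p,n}(K)` such that `(σ F) A = B F`. -/
@[ext]
structure Hom (X Y : FlatSys K σ) : Type where
  /-- the matrix of the morphism -/
  F : Matrix (Fin Y.n) (Fin X.n) K
  comm : F.map σ * X.mat = Y.mat * F

instance : Category (FlatSys K σ) where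
  Hom X Y := Hom X Y
  id X := ⟨1, by
    have h : (1 : Matrix (Fin X.n) (Fin X.n) K).map σ = 1 :=
      Matrix.map_one σ (map_zero σ) (map_one σ)
    rw [h, one_mul, mul_one]⟩
  comp f g := ⟨g.F * f.F, by
    rw [Matrix.map_mul, Matrix.mul_assoc, f.comm, ← Matrix.mul_assoc, g.comm, Matrix.mul_assoc]⟩
  id_comp f := Hom.ext (Matrix.mul_one _)
  comp_id f := Hom.ext (Matrix.one_mul _)
  assoc f g h := Hom.ext (Matrix.mul_assoc _ _ _).symm

@[ext]
theorem hom_ext {X Y : FlatSys K σ} {f g : X ⟶ Y} (h : f.F = g.F) : f = g := Hom.ext h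

@[simp]
theorem id_F (X : FlatSys K σ) : (𝟙 X : X ⟶ X).F = 1 := rfl

@[simp]
theorem comp_F {X Y Z : FlatSys K σ} (f : X ⟶ Y) (g : Y ⟶ Z) : (f ≫ g).F = g.F * f.F := rfl

/-- `(ℂⁿ, A) ⊗ (ℂᵐ, B) = (ℂⁿᵐ, A ⊗ B)`. -/
def tensor (X Y : FlatSys K σ) : FlatSys K σ where
  n := X.n * Y.n
  A :=
    { val := kron (X.A : Matrix _ _ ℂ) (Y.A : Matrix _ _ ℂ)
      inv := kron ((X.A⁻¹ : GL (Fin X.n) ℂ) : Matrix _ _ ℂ) ((Y.A⁻¹ : GL (Fin Y.n) ℂ) : Matrix _ _ ℂ)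
      val_inv := by rw [kron_mul, Units.mul_inv, Units.mul_inv, kron_one]
      inv_val := by rw [kron_mul, Units.inv_mul, Units.inv_mul, kron_one] }

/-- The unit object `(ℂ, 1)`. -/
def unit : FlatSys K σ where
  n := 1
  A := 1

theorem tensor_mat (X Y : FlatSys K σ) : (tensor X Y).mat = kron X.mat Y.mat :=
  kron_map (algebraMap ℂ K) _ _

theorem unit_mat : (unit : FlatSys K σ).mat = 1 :=
  Matrix.map_one _ (map_zero _) (map_one _)

/-- The tensor product of morphisms is the Kronecker product of their matrices. -/
def tensorMap {X₁ Y₁ X₂ Y₂ : FlatSys K σ} (f : X₁ ⟶ Y₁) (g : X₂ ⟶ Y₂) :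
    tensor X₁ X₂ ⟶ tensor Y₁ Y₂ where
  F := kron f.F g.F
  comm := by
    rw [tensor_mat, tensor_mat]
    show (kron f.F g.F).map σ * kron X₁.mat X₂.mat = kron Y₁.mat Y₂.mat * kron f.F g.F
    rw [kron_map, kron_mul, kron_mul, f.comm, g.comm]

/-- A bijection of the indices that carries the matrix of `X` to that of `Y` is an isomorphism. -/
def isoOfEquiv {X Y : FlatSys K σ} (s : Fin X.n ≃ Fin Y.n)
    (h : ∀ i j, Y.mat (s i) (s j) = X.mat i j) : X ≅ Y where
  hom := ⟨permMat K s, by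
    rw [permMat_map, permMat_mul, mul_permMat]
    ext i j
    simp [← h]⟩
  inv := ⟨permMat K s.symm, by
    rw [permMat_map, permMat_mul, mul_permMat]
    ext i j
    simp [← h]⟩
  hom_inv_id := hom_ext (permMat_symm_mul s)
  inv_hom_id := hom_ext (permMat_mul_symm s)

instance : MonoidalCategoryStruct (FlatSys K σ) where
  tensorObj := tensor
  tensorHom f g := tensorMap f g
  whiskerLeft X _ _ f := tensorMap (𝟙 X) f
  whiskerRight f Y := tensorMap f (𝟙 Y)
  tensorUnit := unit
  associator X Y Z := isoOfEquiv (X := tensor (tensor X Y) Z) (Y := tensor X (tensor Y Z))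
    (assocEquiv X.n Y.n Z.n) (by
      rw [tensor_mat, tensor_mat, tensor_mat, tensor_mat]
      exact kron_assoc_apply X.mat Y.mat Z.mat)
  leftUnitor X := isoOfEquiv (X := tensor unit X) (Y := X) (leftEquiv X.n) (by
      rw [tensor_mat, unit_mat]
      exact kron_left_apply X.mat)
  rightUnitor X := isoOfEquiv (X := tensor X unit) (Y := X) (rightEquiv X.n) (by
      rw [tensor_mat, unit_mat]
      exact kron_right_apply X.mat)

theorem tensorHom_F {X₁ Y₁ X₂ Y₂ : FlatSys K σ} (f : X₁ ⟶ Y₁) (g : X₂ ⟶ Y₂) :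
    (f ⊗ₘ g).F = kron f.F g.F := rfl

theorem associator_F (X Y Z : FlatSys K σ) :
    (α_ X Y Z).hom.F = permMat K (assocEquiv X.n Y.n Z.n) := rfl

theorem leftUnitor_F (X : FlatSys K σ) : (λ_ X).hom.F = permMat K (leftEquiv X.n) := rfl

theorem rightUnitor_F (X : FlatSys K σ) : (ρ_ X).hom.F = permMat K (rightEquiv X.n) := rfl

instance : MonoidalCategory (FlatSys K σ) :=
  MonoidalCategory.ofTensorHom
    (id_tensorHom_id := fun X Y => hom_ext (kron_one X.n Y.n))
    (id_tensorHom := fun _ _ _ _ => rfl)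
    (tensorHom_id := fun _ _ => rfl)
    (tensorHom_comp_tensorHom := fun f₁ f₂ g₁ g₂ => hom_ext (kron_mul _ _ _ _))
    (associator_naturality := fun {X₁ X₂ X₃ Y₁ Y₂ Y₃} f₁ f₂ f₃ => hom_ext (by
      show permMat K (assocEquiv Y₁.n Y₂.n Y₃.n) * kron (kron f₁.F f₂.F) f₃.F =
        kron f₁.F (kron f₂.F f₃.F) * permMat K (assocEquiv X₁.n X₂.n X₃.n)
      rw [permMat_mul, mul_permMat]
      ext i j
      simp [kron_apply, assocEquiv, mul_assoc]))
    (leftUnitor_naturality := fun {X Y} f => hom_ext (by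
      show permMat K (leftEquiv Y.n) * kron (1 : Matrix (Fin 1) (Fin 1) K) f.F =
        f.F * permMat K (leftEquiv X.n)
      rw [permMat_mul, mul_permMat]
      ext i j
      simp [kron_apply, leftEquiv, Matrix.one_apply, eq_iff_true_of_subsingleton]))
    (rightUnitor_naturality := fun {X Y} f => hom_ext (by
      show permMat K (rightEquiv Y.n) * kron f.F (1 : Matrix (Fin 1) (Fin 1) K) =
        f.F * permMat K (rightEquiv X.n)
      rw [permMat_mul, mul_permMat]
      ext i j
      simp [kron_apply, rightEquiv, Matrix.one_apply, eq_iff_true_of_subsingleton]))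
    (pentagon := fun W X Y Z => hom_ext (by
      show (kron (1 : Matrix (Fin W.n) (Fin W.n) K) (permMat K (assocEquiv X.n Y.n Z.n)) *
          permMat K (assocEquiv W.n (X.n * Y.n) Z.n)) *
          kron (permMat K (assocEquiv W.n X.n Y.n)) (1 : Matrix (Fin Z.n) (Fin Z.n) K) =
        permMat K (assocEquiv W.n X.n (Y.n * Z.n)) * permMat K (assocEquiv (W.n * X.n) Y.n Z.n)
      rw [← permMat_refl, ← permMat_refl, kron_permMat, kron_permMat, permMat_mul_permMat,
        permMat_mul_permMat, permMat_mul_permMat]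
      congr 1
      ext i
      simp [assocEquiv]))
    (triangle := fun X Y => hom_ext (by
      show kron (1 : Matrix (Fin X.n) (Fin X.n) K) (permMat K (leftEquiv Y.n)) *
          permMat K (assocEquiv X.n 1 Y.n) =
        kron (permMat K (rightEquiv X.n)) (1 : Matrix (Fin Y.n) (Fin Y.n) K)
      rw [← permMat_refl, ← permMat_refl, kron_permMat, kron_permMat, permMat_mul_permMat]
      congr 1
      ext i
      simp [assocEquiv, leftEquiv, rightEquiv, Prod.map]))

end FlatSys

/-! ### Tensor automorphisms -/

theorem inv_isMonoidal {C D : Type*} [Category C] [MonoidalCategory C] [Category D]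
    [MonoidalCategory D] (F : C ⥤ D) [F.Monoidal] (e : F ≅ F) (h : NatTrans.IsMonoidal e.hom) :
    NatTrans.IsMonoidal e.inv := inferInstance

/-- `Aut^⊗(F)`: the group of monoidal natural automorphisms of a monoidal functor. -/
def AutTensor {C D : Type*} [Category C] [MonoidalCategory C] [Category D] [MonoidalCategory D]
    (F : C ⥤ D) [F.Monoidal] : Subgroup (Aut F) where
  carrier := {α | NatTrans.IsMonoidal α.hom}
  one_mem' := inferInstanceAs (NatTrans.IsMonoidal (𝟙 F))
  mul_mem' {α β} hα hβ := by
    have : NatTrans.IsMonoidal α.hom := hα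
    have : NatTrans.IsMonoidal β.hom := hβ
    exact inferInstanceAs (NatTrans.IsMonoidal (β.hom ≫ α.hom))
  inv_mem' {α} hα := inv_isMonoidal F α hα

/-! ### Fibre functors -/

/-- The identification `ℂⁿ ⊗ ℂᵐ = ℂⁿᵐ`. -/
def tensorPi (n m : ℕ) : TensorProduct ℂ (Fin n → ℂ) (Fin m → ℂ) ≃ₗ[ℂ] (Fin (n * m) → ℂ) :=
  (((Pi.basisFun ℂ (Fin n)).tensorProduct (Pi.basisFun ℂ (Fin m))).reindex
    (pairEquiv n m)).equivFun

theorem tensorPi_tmul {n m : ℕ} (x : Fin n → ℂ) (y : Fin m → ℂ) (i : Fin (n * m)) :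
    tensorPi n m (TensorProduct.tmul ℂ x y) i =
      x ((pairEquiv n m).symm i).1 * y ((pairEquiv n m).symm i).2 := by
  unfold tensorPi
  rw [Module.Basis.equivFun_apply, Module.Basis.repr_reindex_apply]
  obtain ⟨⟨a, b⟩, rfl⟩ := (pairEquiv n m).surjective i
  rw [Equiv.symm_apply_apply, Module.Basis.tensorProduct_repr_tmul_apply]
  simp [mul_comm]

theorem kron_mulVec {p₁ n₁ p₂ n₂ : ℕ} (F : Matrix (Fin p₁) (Fin n₁) ℂ)
    (G : Matrix (Fin p₂) (Fin n₂) ℂ) (x : Fin n₁ → ℂ) (y : Fin n₂ → ℂ) :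
    (kron F G).mulVec (tensorPi n₁ n₂ (TensorProduct.tmul ℂ x y)) =
      tensorPi p₁ p₂ (TensorProduct.tmul ℂ (F.mulVec x) (G.mulVec y)) := by
  funext i
  simp only [Matrix.mulVec, dotProduct, tensorPi_tmul, kron_apply]
  rw [← (pairEquiv n₁ n₂).sum_comp, Fintype.sum_prod_type, Finset.sum_mul_sum]
  simp [mul_mul_mul_comm]

theorem permMat_mulVec {n m : ℕ} (s : Fin n ≃ Fin m) (x : Fin n → ℂ) :
    (permMat ℂ s).mulVec x = x ∘ s.symm := by
  funext i
  simp [permMat, Matrix.mulVec, dotProduct, Matrix.one_apply, ← Equiv.symm_apply_eq]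

theorem kron_one_mulVec {p n m : ℕ} (F : Matrix (Fin p) (Fin n) ℂ) (x : Fin n → ℂ)
    (y : Fin m → ℂ) :
    tensorPi p m (TensorProduct.tmul ℂ (F.mulVec x) y) =
      (kron F (1 : Matrix (Fin m) (Fin m) ℂ)).mulVec
        (tensorPi n m (TensorProduct.tmul ℂ x y)) := by
  rw [kron_mulVec, Matrix.one_mulVec]

theorem one_kron_mulVec {p n m : ℕ} (F : Matrix (Fin p) (Fin n) ℂ) (x : Fin n → ℂ)
    (y : Fin m → ℂ) :
    tensorPi m p (TensorProduct.tmul ℂ y (F.mulVec x)) =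
      (kron (1 : Matrix (Fin m) (Fin m) ℂ) F).mulVec
        (tensorPi m n (TensorProduct.tmul ℂ y x)) := by
  rw [kron_mulVec, Matrix.one_mulVec]

theorem assoc_mulVec {a b c : ℕ} (x : Fin a → ℂ) (y : Fin b → ℂ) (z : Fin c → ℂ) :
    (permMat ℂ (assocEquiv a b c)).mulVec (tensorPi (a * b) c
      (TensorProduct.tmul ℂ (tensorPi a b (TensorProduct.tmul ℂ x y)) z)) =
    tensorPi a (b * c) (TensorProduct.tmul ℂ x (tensorPi b c (TensorProduct.tmul ℂ y z))) := by
  rw [permMat_mulVec]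
  funext i
  simp [tensorPi_tmul, assocEquiv, mul_assoc]

theorem left_mulVec {a : ℕ} (c : ℂ) (x : Fin a → ℂ) :
    c • x = (permMat ℂ (leftEquiv a)).mulVec (tensorPi 1 a
      (TensorProduct.tmul ℂ (fun _ => c) x)) := by
  rw [permMat_mulVec]
  funext i
  simp [tensorPi_tmul, leftEquiv]

theorem right_mulVec {a : ℕ} (c : ℂ) (x : Fin a → ℂ) :
    c • x = (permMat ℂ (rightEquiv a)).mulVec (tensorPi a 1
      (TensorProduct.tmul ℂ x (fun _ => c))) := by
  rw [permMat_mulVec]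
  funext i
  simp [tensorPi_tmul, rightEquiv, mul_comm]

namespace FlatSys

variable {K : Type} [CommRing K] [Algebra ℂ K] {σ : K →+* K}

section Fibre

variable (S : Subring K) (ev : S →+* ℂ)
  (hS : ∀ (X Y : FlatSys K σ) (f : X ⟶ Y) (i : Fin Y.n) (j : Fin X.n), f.F i j ∈ S)

/-- The matrix obtained by applying `ev` to all entries of a morphism. -/
def evMat {X Y : FlatSys K σ} (f : X ⟶ Y) : Matrix (Fin Y.n) (Fin X.n) ℂ :=
  Matrix.of fun i j => ev ⟨f.F i j, hS X Y f i j⟩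

theorem evMat_of_map {X Y : FlatSys K σ} (f : X ⟶ Y) (M : Matrix (Fin Y.n) (Fin X.n) S)
    (h : f.F = M.map S.subtype) : evMat S ev hS f = M.map ev := by
  ext i j
  simp only [evMat, Matrix.of_apply, Matrix.map_apply]
  congr 1
  ext
  simp [h]

/-- The entries of a morphism as elements of `S`. -/
def liftMat {X Y : FlatSys K σ} (f : X ⟶ Y) : Matrix (Fin Y.n) (Fin X.n) S :=
  Matrix.of fun i j => ⟨f.F i j, hS X Y f i j⟩

theorem liftMat_map {X Y : FlatSys K σ} (f : X ⟶ Y) : (liftMat S hS f).map S.subtype = f.F := rfl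

theorem evMat_eq {X Y : FlatSys K σ} (f : X ⟶ Y) : evMat S ev hS f = (liftMat S hS f).map ev := rfl

theorem evMat_id (X : FlatSys K σ) : evMat S ev hS (𝟙 X) = 1 := by
  rw [evMat_of_map S ev hS (𝟙 X) 1 (Matrix.map_one _ (map_zero _) (map_one _)).symm]
  exact Matrix.map_one _ (map_zero _) (map_one _)

theorem evMat_comp {X Y Z : FlatSys K σ} (f : X ⟶ Y) (g : Y ⟶ Z) :
    evMat S ev hS (f ≫ g) = evMat S ev hS g * evMat S ev hS f := by
  rw [evMat_of_map S ev hS (f ≫ g) (liftMat S hS g * liftMat S hS f)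
    (by rw [Matrix.map_mul, liftMat_map, liftMat_map, comp_F]), Matrix.map_mul]
  rfl

theorem evMat_tensor {X₁ Y₁ X₂ Y₂ : FlatSys K σ} (f : X₁ ⟶ Y₁) (g : X₂ ⟶ Y₂) :
    evMat S ev hS (f ⊗ₘ g) = kron (evMat S ev hS f) (evMat S ev hS g) := by
  refine (evMat_of_map S ev hS (f ⊗ₘ g) (kron (liftMat S hS f) (liftMat S hS g)) ?_).trans ?_
  · exact (kron_map S.subtype (liftMat S hS f) (liftMat S hS g)).symm
  · exact kron_map ev (liftMat S hS f) (liftMat S hS g)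

theorem evMat_perm {X Y : FlatSys K σ} (f : X ⟶ Y) (s : Fin X.n ≃ Fin Y.n)
    (h : f.F = permMat K s) : evMat S ev hS f = permMat ℂ s := by
  rw [evMat_of_map S ev hS f (permMat S s) (by rw [permMat_map, h]), permMat_map]

/-- The functor `(ℂⁿ, A) ↦ ℂⁿ`, `F ↦ ev F`, for a ring homomorphism `ev` to `ℂ` that is defined on
a subring containing the entries of all morphisms. -/
def fibre : FlatSys K σ ⥤ FGModuleCat ℂ where
  obj X := FGModuleCat.of ℂ (Fin X.n → ℂ)
  map f := FGModuleCat.ofHom (evMat S ev hS f).mulVecLin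
  map_id X := by
    rw [evMat_id, Matrix.mulVecLin_one]
    rfl
  map_comp f g := by
    rw [evMat_comp, Matrix.mulVecLin_mul]
    rfl

theorem fibre_map_apply {X Y : FlatSys K σ} (f : X ⟶ Y) (x : Fin X.n → ℂ) :
    ((fibre S ev hS).map f).hom.hom x = (evMat S ev hS f).mulVec x := rfl

instance fibreMonoidal : (fibre S ev hS).Monoidal :=
  Functor.CoreMonoidal.toMonoidal
    { εIso := (LinearEquiv.funUnique (Fin 1) ℂ ℂ).symm.toFGModuleCatIso
      μIso := fun X Y => (tensorPi X.n Y.n).toFGModuleCatIso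
      μIso_hom_natural_left := by
        intro X Y f X'
        apply FGModuleCat.hom_ext
        refine TensorProduct.ext' fun x y => ?_
        show tensorPi Y.n X'.n (TensorProduct.tmul ℂ ((evMat S ev hS f).mulVec x) y) =
          (evMat S ev hS (f ⊗ₘ 𝟙 X')).mulVec (tensorPi X.n X'.n (TensorProduct.tmul ℂ x y))
        rw [evMat_tensor, evMat_id]
        exact kron_one_mulVec (evMat S ev hS f) x y
      μIso_hom_natural_right := by
        intro X Y X' f
        apply FGModuleCat.hom_ext
        refine TensorProduct.ext' fun x y => ?_
        show tensorPi X'.n Y.n (TensorProduct.tmul ℂ x ((evMat S ev hS f).mulVec y)) =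
          (evMat S ev hS (𝟙 X' ⊗ₘ f)).mulVec (tensorPi X'.n X.n (TensorProduct.tmul ℂ x y))
        rw [evMat_tensor, evMat_id]
        exact one_kron_mulVec (evMat S ev hS f) y x
      associativity := by
        intro X Y Z
        apply FGModuleCat.hom_ext
        refine TensorProduct.ext_threefold fun x y z => ?_
        show (evMat S ev hS (α_ X Y Z).hom).mulVec (tensorPi (X.n * Y.n) Z.n
            (TensorProduct.tmul ℂ (tensorPi X.n Y.n (TensorProduct.tmul ℂ x y)) z)) =
          tensorPi X.n (Y.n * Z.n)
            (TensorProduct.tmul ℂ x (tensorPi Y.n Z.n (TensorProduct.tmul ℂ y z)))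
        rw [evMat_perm S ev hS _ _ (associator_F X Y Z)]
        exact assoc_mulVec x y z
      left_unitality := by
        intro X
        apply FGModuleCat.hom_ext
        refine TensorProduct.ext' fun c x => ?_
        show c • x = (evMat S ev hS (λ_ X).hom).mulVec (tensorPi 1 X.n
            (TensorProduct.tmul ℂ ((LinearEquiv.funUnique (Fin 1) ℂ ℂ).symm c) x))
        rw [evMat_perm S ev hS _ _ (leftUnitor_F X)]
        exact left_mulVec c x
      right_unitality := by
        intro X
        apply FGModuleCat.hom_ext
        refine TensorProduct.ext' fun x c => ?_
        show c • x = (evMat S ev hS (ρ_ X).hom).mulVec (tensorPi X.n 1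
            (TensorProduct.tmul ℂ x ((LinearEquiv.funUnique (Fin 1) ℂ ℂ).symm c)))
        rw [evMat_perm S ev hS _ _ (rightUnitor_F X)]
        exact right_mulVec c x }

end Fibre
end FlatSys
/-! ### Convergent Laurent series -/

/-- The Laurent series `f = ∑ fₖ zᵏ` converges absolutely on the circle `|z| = r`. -/
def SummableAt (r : ℝ) (f : LaurentSeries ℂ) : Prop :=
  Summable fun k : ℤ => ‖f.coeff k‖ * r ^ k

theorem coeff_eq_zero_of_lt (f : LaurentSeries ℂ) : ∃ N : ℤ, ∀ k < N, f.coeff k = 0 := by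
  by_cases h : f = 0
  · exact ⟨0, fun k _ => by simp [h]⟩
  · exact ⟨f.order, fun k hk => HahnSeries.coeff_eq_zero_of_lt_order hk⟩

theorem hasSum_coeff_mul (f g : LaurentSeries ℂ) (k : ℤ) :
    HasSum (fun i : ℤ => f.coeff i * g.coeff (k - i)) ((f * g).coeff k) := by
  classical
  have h : (f * g).coeff k =
      ∑ i ∈ (Finset.antidiagonal f.isPWO_support g.isPWO_support k).image Prod.fst,
        f.coeff i * g.coeff (k - i) := by
    rw [HahnSeries.coeff_mul, Finset.sum_image]
    · refine Finset.sum_congr rfl fun p hp => ?_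
      rw [Finset.mem_antidiagonal] at hp
      rw [← hp.2.2, add_sub_cancel_left]
    · intro p hp p' hp' hpp
      have h1 := (Finset.mem_antidiagonal.mp hp).2.2
      have h2 := (Finset.mem_antidiagonal.mp hp').2.2
      ext
      · exact hpp
      · linarith
  rw [h]
  refine hasSum_sum_of_ne_finset_zero fun i hi => ?_
  by_contra hne
  refine hi (Finset.mem_image.mpr ⟨(i, k - i), ?_, rfl⟩)
  rw [Finset.mem_antidiagonal]
  exact ⟨left_ne_zero_of_mul hne, right_ne_zero_of_mul hne, by simp⟩

theorem SummableAt.prod {r : ℝ} (hr : 0 < r) {f g : LaurentSeries ℂ} (hf : SummableAt r f)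
    (hg : SummableAt r g) :
    Summable fun p : ℤ × ℤ =>
      ‖f.coeff p.2‖ * ‖g.coeff (p.1 - p.2)‖ * r ^ p.1 := by
  have h := hf.mul_of_nonneg hg (fun k => by positivity) (fun k => by positivity)
  let e : ℤ × ℤ ≃ ℤ × ℤ :=
    { toFun := fun p => (p.2, p.1 - p.2)
      invFun := fun p => (p.1 + p.2, p.1)
      left_inv := fun p => by ext <;> simp
      right_inv := fun p => by ext <;> simp }
  refine (e.summable_iff.mpr h).congr fun p => ?_
  simp only [Function.comp, e, Equiv.coe_fn_mk]
  have : r ^ p.1 = r ^ p.2 * r ^ (p.1 - p.2) := by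
    rw [← zpow_add₀ hr.ne']; congr 1; ring
  rw [this]
  ring

theorem SummableAt.mul {r : ℝ} (hr : 0 < r) {f g : LaurentSeries ℂ} (hf : SummableAt r f)
    (hg : SummableAt r g) : SummableAt r (f * g) := by
  have h := hf.prod hr hg
  refine Summable.of_nonneg_of_le (fun k => by positivity) (fun k => ?_) h.prod
  have hk := h.prod_factor k
  simp only [tsum_mul_right]
  gcongr
  rw [← (hasSum_coeff_mul f g k).tsum_eq]
  have hk' : Summable fun i : ℤ => ‖f.coeff i * g.coeff (k - i)‖ := by
    have := hk.mul_right ((r ^ k)⁻¹)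
    refine this.congr fun i => ?_
    rw [norm_mul]
    field_simp
  refine (norm_tsum_le_tsum_norm hk').trans_eq ?_
  simp

theorem SummableAt.of_finite {r : ℝ} {f : LaurentSeries ℂ} (h : f.support.Finite) :
    SummableAt r f := by
  refine summable_of_ne_finset_zero (s := h.toFinset) fun k hk => ?_
  have : f.coeff k = 0 := by simpa using hk
  simp [this]

theorem SummableAt.mono {r s : ℝ} (hs : 0 < s) (hsr : s ≤ r) {f : LaurentSeries ℂ}
    (hf : SummableAt r f) : SummableAt s f := by
  obtain ⟨N, hN⟩ := coeff_eq_zero_of_lt f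
  have hr : 0 < r := hs.trans_le hsr
  refine Summable.of_nonneg_of_le (fun k => by positivity) (fun k => ?_)
    (hf.mul_right ((s / r) ^ N))
  by_cases hk : k < N
  · simp [hN k hk]
  · have h1 : (s / r) ^ k ≤ (s / r) ^ N :=
      zpow_le_zpow_right_of_le_one₀ (by positivity) ((div_le_one hr).mpr hsr) (not_lt.mp hk)
    have h2 : s ^ k = r ^ k * (s / r) ^ k := by
      rw [div_zpow]; field_simp
    rw [h2, mul_assoc]
    gcongr

/-- The ring of Laurent series (with finite principal part) that converge absolutely on the
circle `|z| = r`. -/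
def summableRing (r : ℝ) (hr : 0 < r) : Subring (LaurentSeries ℂ) where
  carrier := {f | SummableAt r f}
  mul_mem' hf hg := SummableAt.mul hr hf hg
  one_mem' := SummableAt.of_finite ((Set.finite_singleton 0).subset HahnSeries.support_single_subset)
  add_mem' {f g} hf hg := by
    refine Summable.of_nonneg_of_le (fun k => by positivity) (fun k => ?_) (Summable.add hf hg)
    rw [← add_mul, HahnSeries.coeff_add]
    gcongr
    exact norm_add_le _ _
  zero_mem' := SummableAt.of_finite (by simp)
  neg_mem' {f} hf := by
    refine Summable.congr hf fun k => ?_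
    simp

/-- `ℂ({z})`: the convergent Laurent series, i.e. germs at `0` of meromorphic functions. -/
def ConvLaurent : Subring (LaurentSeries ℂ) where
  carrier := {f | ∃ r : ℝ, 0 < r ∧ SummableAt r f}
  mul_mem' := by
    rintro f g ⟨r, hr, hf⟩ ⟨s, hs, hg⟩
    have h := lt_min hr hs
    exact ⟨min r s, h, (hf.mono h (min_le_left _ _)).mul h (hg.mono h (min_le_right _ _))⟩
  one_mem' := ⟨1, one_pos, (summableRing 1 one_pos).one_mem⟩
  add_mem' := by
    rintro f g ⟨r, hr, hf⟩ ⟨s, hs, hg⟩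
    have h := lt_min hr hs
    exact ⟨min r s, h, (summableRing _ h).add_mem (hf.mono h (min_le_left _ _))
      (hg.mono h (min_le_right _ _))⟩
  zero_mem' := ⟨1, one_pos, (summableRing 1 one_pos).zero_mem⟩
  neg_mem' := by
    rintro f ⟨r, hr, hf⟩
    exact ⟨r, hr, (summableRing r hr).neg_mem hf⟩

theorem summableAt_C (r : ℝ) (c : ℂ) : SummableAt r (HahnSeries.C c) :=
  SummableAt.of_finite ((Set.finite_singleton 0).subset HahnSeries.support_single_subset)

/-- The constants `ℂ → ℂ({z})`. -/
def constSeries : ℂ →+* ConvLaurent :=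
  RingHom.codRestrict (HahnSeries.C : ℂ →+* LaurentSeries ℂ) ConvLaurent
    fun c => ⟨1, one_pos, summableAt_C 1 c⟩

instance : Algebra ℂ ConvLaurent := constSeries.toAlgebra

/-- `f(z) ↦ f(q z)` on formal Laurent series: the coefficient of `zᵏ` is multiplied by `qᵏ`. -/
def scale (q : ℂˣ) (f : LaurentSeries ℂ) : LaurentSeries ℂ where
  coeff k := (q : ℂ) ^ k * f.coeff k
  isPWO_support' := f.isPWO_support.mono fun k hk => by
    intro h
    exact hk (by simp [h])

theorem scale_coeff (q : ℂˣ) (f : LaurentSeries ℂ) (k : ℤ) :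
    (scale q f).coeff k = (q : ℂ) ^ k * f.coeff k := rfl

theorem scale_mul (q : ℂˣ) (f g : LaurentSeries ℂ) :
    scale q (f * g) = scale q f * scale q g := by
  ext k
  rw [scale_coeff]
  refine ((hasSum_coeff_mul f g k).mul_left ((q : ℂ) ^ k)).unique ?_
  have h := hasSum_coeff_mul (scale q f) (scale q g) k
  refine Eq.mp (congrArg (fun u => HasSum u _) (funext fun i => ?_)) h
  have hq : (q : ℂ) ^ k = (q : ℂ) ^ i * (q : ℂ) ^ (k - i) := by
    rw [← zpow_add₀ q.ne_zero]
    congr 1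
    ring
  rw [scale_coeff, scale_coeff, hq]
  ring

theorem SummableAt.scale {r : ℝ} (q : ℂˣ) {f : LaurentSeries ℂ} (hf : SummableAt r f) :
    SummableAt (r / ‖(q : ℂ)‖) (QDiff.scale q f) := by
  refine Summable.congr hf fun k => ?_
  have : ‖(q : ℂ)‖ ^ k ≠ 0 := zpow_ne_zero _ (by simp)
  rw [scale_coeff, norm_mul, norm_zpow, div_zpow]
  field_simp

/-- The automorphism `σ_q : f(z) ↦ f(q z)` of `ℂ({z})`. -/
def sigmaQ (q : ℂˣ) : ConvLaurent →+* ConvLaurent where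
  toFun f := ⟨scale q f.1, by
    obtain ⟨r, hr, hf⟩ := f.2
    exact ⟨r / ‖(q : ℂ)‖, div_pos hr (by simp), hf.scale q⟩⟩
  map_one' := by
    ext k
    show (q : ℂ) ^ k * (1 : LaurentSeries ℂ).coeff k = (1 : LaurentSeries ℂ).coeff k
    rw [HahnSeries.coeff_one]
    split_ifs with h <;> simp [h]
  map_zero' := by
    ext k
    show (q : ℂ) ^ k * (0 : LaurentSeries ℂ).coeff k = (0 : LaurentSeries ℂ).coeff k
    simp
  map_add' f g := by
    ext k
    exact mul_add _ _ _
  map_mul' f g := Subtype.ext (scale_mul q f.1 g.1)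

theorem eval_summable (z : ℂˣ) {f : LaurentSeries ℂ} (hf : SummableAt ‖(z : ℂ)‖ f) :
    Summable fun k : ℤ => ‖f.coeff k * (z : ℂ) ^ k‖ :=
  Summable.congr hf fun k => by rw [norm_mul, norm_zpow]

/-- The value at `z ≠ 0` of a Laurent series that converges absolutely at `z`. -/
def evalSeries (z : ℂˣ) (f : LaurentSeries ℂ) : ℂ := ∑' k : ℤ, f.coeff k * (z : ℂ) ^ k

theorem evalSeries_mul (z : ℂˣ) {f g : LaurentSeries ℂ} (hf : SummableAt ‖(z : ℂ)‖ f)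
    (hg : SummableAt ‖(z : ℂ)‖ g) : evalSeries z (f * g) = evalSeries z f * evalSeries z g := by
  have hz : 0 < ‖(z : ℂ)‖ := by simp
  let e : ℤ × ℤ ≃ ℤ × ℤ :=
    { toFun := fun p => (p.2, p.1 - p.2)
      invFun := fun p => (p.1 + p.2, p.1)
      left_inv := fun p => by ext <;> simp
      right_inv := fun p => by ext <;> simp }
  have hzk : ∀ k i : ℤ, (z : ℂ) ^ k = (z : ℂ) ^ i * (z : ℂ) ^ (k - i) := fun k i => by
    rw [← zpow_add₀ z.ne_zero]
    congr 1
    ring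
  have hs : Summable fun p : ℤ × ℤ => f.coeff p.2 * g.coeff (p.1 - p.2) * (z : ℂ) ^ p.1 := by
    refine Summable.of_norm ((hf.prod hz hg).congr fun p => ?_)
    rw [norm_mul, norm_mul, norm_zpow]
  unfold evalSeries
  rw [tsum_mul_tsum_of_summable_norm (eval_summable z hf) (eval_summable z hg), ← e.tsum_eq]
  have h1 : (fun p : ℤ × ℤ => f.coeff (e p).1 * (z : ℂ) ^ (e p).1 *
      (g.coeff (e p).2 * (z : ℂ) ^ (e p).2)) =
      fun p => f.coeff p.2 * g.coeff (p.1 - p.2) * (z : ℂ) ^ p.1 := by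
    funext p
    rw [hzk p.1 p.2]
    simp only [e, Equiv.coe_fn_mk]
    ring
  rw [h1, hs.tsum_prod]
  refine tsum_congr fun k => ?_
  simp only [tsum_mul_right]
  rw [(hasSum_coeff_mul f g k).tsum_eq]

/-- Evaluation at `z` as a ring homomorphism. -/
def evalHom (z : ℂˣ) :
    (summableRing ‖(z : ℂ)‖ (by simp)).comap ConvLaurent.subtype →+* ℂ where
  toFun f := evalSeries z f.1.1
  map_one' := by
    show ∑' k : ℤ, (1 : LaurentSeries ℂ).coeff k * (z : ℂ) ^ k = 1
    rw [tsum_eq_single 0]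
    · simp
    · intro k hk
      simp [HahnSeries.coeff_one, hk]
  map_zero' := by
    show ∑' k : ℤ, (0 : LaurentSeries ℂ).coeff k * (z : ℂ) ^ k = 0
    simp
  map_add' f g := by
    show ∑' k : ℤ, (f.1.1 + g.1.1).coeff k * (z : ℂ) ^ k = _
    simp only [HahnSeries.coeff_add, add_mul]
    exact (eval_summable z f.2).of_norm.tsum_add (eval_summable z g.2).of_norm
  map_mul' f g := evalSeries_mul z f.2 g.2


/-! ### The categories and their fibre functors -/

/-- The category `ℛ = Rep_ℂ(ℤ)`: objects `(ℂⁿ, A)`, morphisms the complex matrices `F` with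
`F A = B F`. -/
abbrev RepZ : Type := FlatSys ℂ (RingHom.id ℂ)

/-- The category `𝒫⁽⁰⁾` of flat `q`-difference systems: objects `(ℂⁿ, A)`, morphisms the matrices
`F` with coefficients in `ℂ({z})` such that `F(qz) A = B F(z)`. -/
abbrev P0 (q : ℂˣ) : Type := FlatSys ConvLaurent (sigmaQ q)

/-- The forgetful functor `ω : ℛ → Vect`, `(ℂⁿ, A) ↦ ℂⁿ`, `F ↦ F`. -/
def forgetR : RepZ ⥤ FGModuleCat ℂ :=
  FlatSys.fibre ⊤ (Subring.subtype ⊤) fun _ _ _ _ _ => Subring.mem_top _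

instance : forgetR.Monoidal := FlatSys.fibreMonoidal _ _ _

/-- The coefficient of `zᵏ`. -/
def coeffHom (k : ℤ) : ConvLaurent →+ ℂ where
  toFun f := f.1.coeff k
  map_zero' := rfl
  map_add' _ _ := rfl

theorem coeffHom_mul_const (k : ℤ) (f : ConvLaurent) (c : ℂ) :
    coeffHom k (f * algebraMap ℂ ConvLaurent c) = coeffHom k f * c :=
  HahnSeries.coeff_mul_single_zero

theorem coeffHom_const_mul (k : ℤ) (f : ConvLaurent) (c : ℂ) :
    coeffHom k (algebraMap ℂ ConvLaurent c * f) = c * coeffHom k f :=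
  HahnSeries.coeff_single_zero_mul

theorem P0.coeff_comm {q : ℂˣ} {X Y : P0 q} (f : X ⟶ Y) (k : ℤ) :
    (q : ℂ) ^ k • (f.F.map (coeffHom k) * X.A.val) = Y.A.val * f.F.map (coeffHom k) := by
  ext i j
  have h := congrArg (coeffHom k) (congrFun (congrFun f.comm i) j)
  rw [Matrix.mul_apply, Matrix.mul_apply, map_sum, map_sum] at h
  simp only [FlatSys.mat, Matrix.map_apply, coeffHom_mul_const, coeffHom_const_mul] at h
  rw [Matrix.smul_apply, Matrix.mul_apply, Matrix.mul_apply, smul_eq_mul, Finset.mul_sum]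
  simp only [Matrix.map_apply]
  rw [← h]
  refine Finset.sum_congr rfl fun l _ => ?_
  rw [← mul_assoc]
  rfl

section Bound

attribute [local instance] Matrix.linftyOpNormedAddCommGroup Matrix.linftyOpNormedSpace

/-- As `|q| > 1`, the coefficients of a morphism of `𝒫⁽⁰⁾` vanish in high degree. -/
theorem P0.coeff_eventually_zero {q : ℂˣ} (hq : 1 < ‖(q : ℂ)‖) {X Y : P0 q} (f : X ⟶ Y) :
    ∃ N : ℤ, ∀ k, N < k → f.F.map (coeffHom k) = 0 := by
  obtain ⟨N, hN⟩ := pow_unbounded_of_one_lt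
    (‖Y.A.val‖ * ‖X.A⁻¹.val‖) hq
  refine ⟨N, fun k hk => ?_⟩
  have h := congrArg (fun M => M * X.A⁻¹.val) (P0.coeff_comm f k)
  simp only [Matrix.smul_mul, Matrix.mul_assoc, Units.mul_inv, Matrix.mul_one] at h
  by_contra hne
  have hpos : 0 < ‖f.F.map (coeffHom k)‖ := norm_pos_iff.mpr hne
  have h1 := congrArg norm h
  rw [norm_smul, norm_zpow] at h1
  have h2 := (Matrix.linfty_opNorm_mul Y.A.val
    (f.F.map (coeffHom k) * X.A⁻¹.val)).trans
    (mul_le_mul_of_nonneg_left (Matrix.linfty_opNorm_mul (f.F.map (coeffHom k))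
      X.A⁻¹.val) (norm_nonneg _))
  rw [← h1] at h2
  have h3 : ‖(q : ℂ)‖ ^ N ≤ ‖(q : ℂ)‖ ^ k := by
    rw [← zpow_natCast]
    exact zpow_le_zpow_right₀ hq.le hk.le
  nlinarith [mul_lt_mul_of_pos_right (hN.trans_le h3) hpos]

end Bound

/-- The entries of a morphism of `𝒫⁽⁰⁾` are Laurent polynomials, so that they may be evaluated at
every `z ≠ 0`. -/
theorem P0.entry_finite {q : ℂˣ} (hq : 1 < ‖(q : ℂ)‖) {X Y : P0 q} (f : X ⟶ Y)
    (i : Fin Y.n) (j : Fin X.n) : (f.F i j).1.support.Finite := by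
  obtain ⟨N, hN⟩ := P0.coeff_eventually_zero hq f
  obtain ⟨M, hM⟩ := coeff_eq_zero_of_lt (f.F i j).1
  refine (Set.finite_Icc M N).subset fun k hk => ⟨?_, ?_⟩
  · by_contra h
    exact hk (hM k (not_le.mp h))
  · by_contra h
    exact hk (congrFun (congrFun (hN k (not_le.mp h)) i) j)

/-- The fibre functor `ω_{z₀}⁽⁰⁾ : 𝒫⁽⁰⁾ → Vect`, `(ℂⁿ, A) ↦ ℂⁿ`, `F ↦ F(z₀)`. -/
def omega (q : ℂˣ) (hq : 1 < ‖(q : ℂ)‖) (z₀ : ℂˣ) : P0 q ⥤ FGModuleCat ℂ :=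
  FlatSys.fibre _ (evalHom z₀) fun _ _ f i j => SummableAt.of_finite (P0.entry_finite hq f i j)

instance (q : ℂˣ) (hq : 1 < ‖(q : ℂ)‖) (z₀ : ℂˣ) : (omega q hq z₀).Monoidal :=
  FlatSys.fibreMonoidal _ _ _

/-- The action of `ω_{z₀}⁽⁰⁾` on morphisms is evaluation at `z₀`. -/
theorem omega_map_apply (q : ℂˣ) (hq : 1 < ‖(q : ℂ)‖) (z₀ : ℂˣ) {X Y : P0 q} (f : X ⟶ Y)
    (x : Fin X.n → ℂ) :
    ((omega q hq z₀).map f).hom.hom x =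
      (f.F.map fun g : ConvLaurent => evalSeries z₀ g.1).mulVec x := rfl

theorem sigmaQ_const (q : ℂˣ) (c : ℂ) :
    sigmaQ q (algebraMap ℂ ConvLaurent c) = algebraMap ℂ ConvLaurent c := by
  ext k
  show (q : ℂ) ^ k * (HahnSeries.single (0 : ℤ) c).coeff k = (HahnSeries.single (0 : ℤ) c).coeff k
  by_cases h : k = 0
  · simp [h]
  · simp [HahnSeries.coeff_single_of_ne h]

theorem evalSeries_const (z : ℂˣ) (c : ℂ) :
    evalSeries z (algebraMap ℂ ConvLaurent c).1 = c := by
  show ∑' k : ℤ, (HahnSeries.single (0 : ℤ) c).coeff k * (z : ℂ) ^ k = c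
  rw [tsum_eq_single 0]
  · simp
  · intro k hk
    simp [HahnSeries.coeff_single_of_ne hk]

/-- The embedding `ℛ → 𝒫⁽⁰⁾`: the identity on objects, and a constant matrix `F` is considered as
a matrix with coefficients in `ℂ({z})`. -/
def inclR (q : ℂˣ) : RepZ ⥤ P0 q where
  obj X := ⟨X.n, X.A⟩
  map {X Y} f :=
    { F := f.F.map (algebraMap ℂ ConvLaurent)
      comm := by
        have h : (f.F.map (algebraMap ℂ ConvLaurent)).map (sigmaQ q) =
            f.F.map (algebraMap ℂ ConvLaurent) := by
          ext1 i j
          exact sigmaQ_const q _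
        rw [h]
        exact (Matrix.map_mul (f := algebraMap ℂ ConvLaurent)).symm.trans
          ((congrArg (fun M : Matrix _ _ ℂ => M.map (algebraMap ℂ ConvLaurent)) f.comm).trans
            Matrix.map_mul) }
  map_id X := FlatSys.hom_ext (Matrix.map_one _ (map_zero _) (map_one _))
  map_comp f g := FlatSys.hom_ext Matrix.map_mul

/-- `ω_{z₀}⁽⁰⁾` restricts to the forgetful functor `ω` on `ℛ`. -/
theorem omega_inclR_map (q : ℂˣ) (hq : 1 < ‖(q : ℂ)‖) (z₀ : ℂˣ) {X Y : RepZ} (f : X ⟶ Y) :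
    (omega q hq z₀).map ((inclR q).map f) = forgetR.map f := by
  apply FGModuleCat.hom_ext
  refine LinearMap.ext fun x => ?_
  refine (omega_map_apply q hq z₀ ((inclR q).map f) x).trans ?_
  have h : (((inclR q).map f).F.map fun g : ConvLaurent => evalSeries z₀ g.1) = f.F := by
    ext i j
    exact evalSeries_const z₀ _
  rw [h]
  rfl

/-- Restriction `Aut(ω_{z₀}⁽⁰⁾) → Aut(ω)` along `ℛ → 𝒫⁽⁰⁾`: the component at `(ℂⁿ, A)` is kept. -/
def restrictAut (q : ℂˣ) (hq : 1 < ‖(q : ℂ)‖) (z₀ : ℂˣ) (α : Aut (omega q hq z₀)) :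
    Aut forgetR :=
  NatIso.ofComponents (fun X => α.app ((inclR q).obj X)) fun f => by
    have h := α.hom.naturality ((inclR q).map f)
    rw [omega_inclR_map] at h
    exact h

/-- Restriction `Aut^⊗(ω_{z₀}⁽⁰⁾) → Aut^⊗(ω)`. -/
def restrict (q : ℂˣ) (hq : 1 < ‖(q : ℂ)‖) (z₀ : ℂˣ) :
    AutTensor (omega q hq z₀) →* AutTensor forgetR where
  toFun α := ⟨restrictAut q hq z₀ α.1,
    { unit := α.2.unit
      tensor := fun X Y => α.2.tensor ((inclR q).obj X) ((inclR q).obj Y) }⟩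
  map_one' := rfl
  map_mul' _ _ := rfl

/-- The matrix of the component at `(ℂⁿ, A)` of an automorphism of the forgetful functor. -/
def compMat (α : Aut forgetR) (X : RepZ) : Matrix (Fin X.n) (Fin X.n) ℂ :=
  LinearMap.toMatrix' (m := Fin X.n) (n := Fin X.n) (α.hom.app X).hom.hom

/-! ### The proalgebraic hull of `ℤ` -/

/-- `ℤ^alg = Hom_grp(ℂ*, ℂ*) × ℂ` (with `ℂ` as an additive group). -/
abbrev Zalg : Type := (ℂˣ →* ℂˣ) × Multiplicative ℂ

/-- The power `U^λ = ∑_{k ≥ 0} (λ choose k) (U - 1)^k` of a unipotent `n × n` matrix; the terms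
with `k ≥ n` vanish. -/
def unipotentPow {n : ℕ} (U : Matrix (Fin n) (Fin n) ℂ) (lam : ℂ) : Matrix (Fin n) (Fin n) ℂ :=
  ∑ k ∈ Finset.range n, Ring.choose lam k • (U - 1) ^ k

/-- The semisimple matrix `Q diag(c₁, …, cₙ) Q⁻¹`. -/
def conjDiag {n : ℕ} (Q : GL (Fin n) ℂ) (c : Fin n → ℂˣ) : Matrix (Fin n) (Fin n) ℂ :=
  (Q : Matrix _ _ ℂ) * Matrix.diagonal (fun i => (c i : ℂ)) *
    ((Q⁻¹ : GL (Fin n) ℂ) : Matrix _ _ ℂ)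

/-- `M = A^{(γ,λ)} = γ(A_s) A_u^λ`, where `A = A_s A_u` is the multiplicative Dunford decomposition
(`A_s = Q diag(c) Q⁻¹` semisimple, `A_u = U` unipotent, `A_s` and `A_u` commute) and
`γ(A_s) = Q diag(γ(c)) Q⁻¹`. -/
def IsIncarnation (g : Zalg) {n : ℕ} (A : GL (Fin n) ℂ) (M : Matrix (Fin n) (Fin n) ℂ) : Prop :=
  ∃ (Q : GL (Fin n) ℂ) (c : Fin n → ℂˣ) (U : Matrix (Fin n) (Fin n) ℂ),
    IsNilpotent (U - 1) ∧ Commute (conjDiag Q c) U ∧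
    (A : Matrix (Fin n) (Fin n) ℂ) = conjDiag Q c * U ∧
    M = conjDiag Q (fun i => g.1 (c i)) * unipotentPow U (Multiplicative.toAdd g.2)

/-- The subgroup `{(γ, λ) ∈ ℤ^alg | γ(q) = 1}`. -/
def localSubgroup (q : ℂˣ) : Subgroup Zalg where
  carrier := {g | g.1 q = 1}
  one_mem' := rfl
  mul_mem' {g h} hg hh := by
    show g.1 q * h.1 q = 1
    rw [show g.1 q = 1 from hg, show h.1 q = 1 from hh, one_mul]
  inv_mem' {g} hg := by
    show (g.1 q)⁻¹ = 1
    rw [show g.1 q = 1 from hg, inv_one]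

end QDiff

end

/-!
The matrix `A^{(γ,λ)}` is a polynomial in `A`, and one polynomial serves for two matrices at once;
so `A^{(γ,λ)}` is well defined and commutes with every intertwiner. Conversely, naturality for
subrepresentations shows that the value of a tensor automorphism of `ω` on a matrix coefficient
`m ↦ φ(Aᵐ v)` depends on that function only, and compatibility with `⊗` makes it multiplicative. As
these functions are linear combinations of the products of `m ↦ cᵐ` and `m ↦ choose m k`, a
polynomial in `m`, a tensor automorphism is determined by its values `γ(c)` on the rank one
representations and `λ` on the Jordan block.

Naturality for the morphism `z : (ℂ, 1) → (ℂ, q)` of `𝒫⁽⁰⁾` forces `γ(q) = 1`. Conversely, the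
coefficients of a morphism satisfy `F_k (qᵏ A) = B F_k`, and `(qᵏ A)^{(γ,λ)} = A^{(γ,λ)}` as soon as
`γ(q) = 1`, so that every `F_k`, hence the finite sum `F(z₀)`, intertwines `A^{(γ,λ)}` and
`B^{(γ,λ)}`.
-/

open Polynomial

noncomputable section

namespace QDiff

/-! ### Power series at nilpotent elements -/

section NilpotentEvaluation

open PowerSeries (trunc)

variable {R A : Type*} [CommRing R] [Ring A] [Algebra R A] {a : A} {n : ℕ}

theorem aeval_trunc_coe (ha : a ^ n = 0) (p : R[X]) :
    aeval a (trunc n (p : PowerSeries R)) = aeval a p := by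
  have hdvd : (X : R[X]) ^ n ∣ p - trunc n (p : PowerSeries R) := by
    refine X_pow_dvd_iff.mpr fun k hk => ?_
    rw [coeff_sub, PowerSeries.coeff_trunc, if_pos hk, coeff_coe, sub_self]
  obtain ⟨r, hr⟩ := hdvd
  rw [eq_comm, ← sub_eq_zero, ← map_sub, hr, map_mul, map_pow, aeval_X, ha, zero_mul]

theorem aeval_trunc_mul (ha : a ^ n = 0) (f g : PowerSeries R) :
    aeval a (trunc n (f * g)) = aeval a (trunc n f) * aeval a (trunc n g) := by
  rw [← PowerSeries.trunc_trunc_mul_trunc, ← coe_mul, aeval_trunc_coe ha, map_mul]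

end NilpotentEvaluation

/-! ### Kronecker products -/

section Kron

variable {R : Type} [CommRing R] {n p : ℕ}

theorem kron_pow (M : Matrix (Fin n) (Fin n) R) (N : Matrix (Fin p) (Fin p) R) (m : ℕ) :
    kron M N ^ m = kron (M ^ m) (N ^ m) := by
  induction m with
  | zero => simp only [pow_zero, kron_one]
  | succ m ih => rw [pow_succ, ih, kron_mul, ← pow_succ, ← pow_succ]

theorem isNilpotent_kron_left {M : Matrix (Fin n) (Fin n) R} (hM : IsNilpotent M)
    (N : Matrix (Fin p) (Fin p) R) : IsNilpotent (kron M N) := by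
  obtain ⟨k, hk⟩ := hM
  refine ⟨k, ?_⟩
  rw [kron_pow, hk]
  ext i j
  simp [kron_apply]

theorem isNilpotent_kron_right (M : Matrix (Fin n) (Fin n) R) {N : Matrix (Fin p) (Fin p) R}
    (hN : IsNilpotent N) : IsNilpotent (kron M N) := by
  obtain ⟨k, hk⟩ := hN
  refine ⟨k, ?_⟩
  rw [kron_pow, hk]
  ext i j
  simp [kron_apply]

theorem isNilpotent_kron_sub_one {U : Matrix (Fin n) (Fin n) R} {V : Matrix (Fin p) (Fin p) R}
    (hU : IsNilpotent (U - 1)) (hV : IsNilpotent (V - 1)) : IsNilpotent (kron U V - 1) := by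
  have hsplit : kron U V - 1 = kron (U - 1) V + kron 1 (V - 1) := by
    rw [← kron_one]
    ext i j
    simp only [kron_apply, Matrix.sub_apply, Matrix.add_apply]
    ring
  have hcomm : Commute (kron (U - 1) V) (kron 1 (V - 1)) := by
    rw [Commute, SemiconjBy, kron_mul, kron_mul, one_mul, mul_one, mul_sub, sub_mul, mul_one,
      one_mul]
  rw [hsplit]
  exact hcomm.isNilpotent_add (isNilpotent_kron_left hU V) (isNilpotent_kron_right 1 hV)

end Kron

/-! ### Complex powers of unipotent matrices -/

section UnipotentPow

variable {n p : ℕ} {U : Matrix (Fin n) (Fin n) ℂ} {V : Matrix (Fin p) (Fin p) ℂ}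

theorem pow_eq_zero_of_isNilpotent_matrix {K : Type*} [Field K] {N : Matrix (Fin n) (Fin n) K}
    (h : IsNilpotent N) : N ^ n = 0 := by
  have hchar : N.charpoly = X ^ n := by
    simpa [sub_eq_zero] using (Matrix.isNilpotent_charpoly_sub_pow_of_isNilpotent h).eq_zero
  simpa [hchar] using Matrix.aeval_self_charpoly N

theorem unipotentPow_eq_aeval (hU : IsNilpotent (U - 1)) (z : ℂ) {N : ℕ} (hN : n ≤ N) :
    unipotentPow U z =
      aeval (U - 1) (PowerSeries.trunc N (PowerSeries.binomialSeries ℂ z)) := by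
  simp only [PowerSeries.trunc_apply, Nat.Ico_zero_eq_range, map_sum, aeval_monomial,
    PowerSeries.binomialSeries_coeff, unipotentPow, smul_eq_mul, mul_one, ← Algebra.smul_def]
  refine Finset.sum_subset (Finset.range_mono hN) fun k _ hk => ?_
  rw [pow_eq_zero_of_le (by simpa using hk) (pow_eq_zero_of_isNilpotent_matrix hU), smul_zero]

theorem unipotentPow_add (hU : IsNilpotent (U - 1)) (z w : ℂ) :
    unipotentPow U (z + w) = unipotentPow U z * unipotentPow U w := by
  simp only [unipotentPow_eq_aeval hU _ le_rfl, PowerSeries.binomialSeries_add,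
    aeval_trunc_mul (pow_eq_zero_of_isNilpotent_matrix hU)]

theorem unipotentPow_natCast (hU : IsNilpotent (U - 1)) (m : ℕ) : unipotentPow U m = U ^ m := by
  have hcoe : (1 + PowerSeries.X) ^ m = (((1 + X) ^ m : ℂ[X]) : PowerSeries ℂ) := by simp
  rw [unipotentPow_eq_aeval hU _ le_rfl, PowerSeries.binomialSeries_nat, hcoe,
    aeval_trunc_coe (pow_eq_zero_of_isNilpotent_matrix hU)]
  simp

theorem unipotentPow_zero (hU : IsNilpotent (U - 1)) : unipotentPow U 0 = 1 := by
  simpa using unipotentPow_natCast hU 0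

theorem unipotentPow_one_left (z : ℂ) :
    unipotentPow (1 : Matrix (Fin n) (Fin n) ℂ) z = 1 := by
  have hnil : IsNilpotent ((1 : Matrix (Fin n) (Fin n) ℂ) - 1) := by simp
  rw [unipotentPow_eq_aeval hnil z n.le_succ, sub_self, ← coeff_zero_eq_aeval_zero']
  simp [PowerSeries.coeff_trunc]

theorem commute_unipotentPow {S : Matrix (Fin n) (Fin n) ℂ} (h : Commute S U) (z : ℂ) :
    Commute S (unipotentPow U z) :=
  Commute.sum_right _ _ _ fun k _ => ((h.sub_right (Commute.one_right S)).pow_right k).smul_right _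

/-- The polynomial `X (X - 1) ⋯ (X - k + 1) / k!`, which expresses `Ring.choose z k` as a
polynomial function of `z`. -/
def choosePoly (k : ℕ) : ℂ[X] :=
  C ((k.factorial : ℂ)⁻¹) * (descPochhammer ℤ k).map (Int.castRingHom ℂ)

theorem eval_choosePoly (k : ℕ) (z : ℂ) : (choosePoly k).eval z = Ring.choose z k := by
  rw [Ring.choose_eq_smul, ← aeval_eq_smeval, choosePoly, eval_mul, eval_C,
    Polynomial.eval_map, smul_eq_mul]
  rfl

/-- The matrix of polynomials in `z` whose value at `z` is `U ^ z`, for `U` unipotent. -/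
def unipotentPoly (U : Matrix (Fin n) (Fin n) ℂ) : Matrix (Fin n) (Fin n) ℂ[X] :=
  ∑ k ∈ Finset.range n, choosePoly k • ((U - 1) ^ k).map C

theorem unipotentPoly_map_eval (U : Matrix (Fin n) (Fin n) ℂ) (z : ℂ) :
    (unipotentPoly U).map (evalRingHom z) = unipotentPow U z := by
  ext i j
  simp [unipotentPoly, unipotentPow, Matrix.sum_apply, eval_finsetSum, eval_choosePoly]

theorem eq_of_eval_natCast_eq {R : Type*} [CommRing R] [IsDomain R] [CharZero R] {f g : R[X]}
    (h : ∀ m : ℕ, f.eval (m : R) = g.eval (m : R)) : f = g := by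
  refine eq_of_infinite_eval_eq f g
    ((Set.infinite_range_of_injective (Nat.cast_injective (R := R))).mono ?_)
  rintro _ ⟨m, rfl⟩
  exact h m

theorem unipotentPow_kron (hU : IsNilpotent (U - 1)) (hV : IsNilpotent (V - 1)) (z : ℂ) :
    unipotentPow (kron U V) z = kron (unipotentPow U z) (unipotentPow V z) := by
  have key : unipotentPoly (kron U V) = kron (unipotentPoly U) (unipotentPoly V) := by
    ext1 i j
    refine eq_of_eval_natCast_eq fun m => ?_
    have hm : (unipotentPoly (kron U V)).map (evalRingHom (m : ℂ)) =
        (kron (unipotentPoly U) (unipotentPoly V)).map (evalRingHom (m : ℂ)) := by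
      rw [kron_map, unipotentPoly_map_eval, unipotentPoly_map_eval, unipotentPoly_map_eval,
        unipotentPow_natCast hU, unipotentPow_natCast hV,
        unipotentPow_natCast (isNilpotent_kron_sub_one hU hV), kron_pow]
    exact congrFun (congrFun hm i) j
  rw [← unipotentPoly_map_eval, key, kron_map, unipotentPoly_map_eval, unipotentPoly_map_eval]

end UnipotentPow

/-! ### Diagonalizable matrices -/

theorem exists_forall_X_sub_C_pow_dvd_sub {K : Type*} [Field K] (s : Finset K) (N : ℕ)
    (f : K → K[X]) : ∃ P : K[X], ∀ c ∈ s, (X - C c) ^ N ∣ P - f c := by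
  have hcoprime : Pairwise (Function.onFun IsCoprime fun c : s => Ideal.span {(X - C c.1) ^ N}) :=
    fun c d hcd => by
      rw [Function.onFun, Ideal.isCoprime_span_singleton_iff]
      exact (isCoprime_X_sub_C_of_isUnit_sub
        (sub_ne_zero.mpr (Subtype.coe_injective.ne hcd)).isUnit).pow
  obtain ⟨P, hP⟩ := Ideal.exists_forall_sub_mem_ideal hcoprime fun c => f c
  exact ⟨P, fun c hc => Ideal.mem_span_singleton.mp (hP ⟨c, hc⟩)⟩

theorem aeval_mul_mulVec_of_mulVec_eq_smul {R : Type*} [CommRing R] {n : ℕ}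
    {S U : Matrix (Fin n) (Fin n) R} (hSU : Commute S U) {c : R} {v : Fin n → R}
    (hv : S.mulVec v = c • v) (P : R[X]) :
    (aeval (S * U) P).mulVec v = (aeval (c • U) P).mulVec v := by
  have hpow (k : ℕ) : (S ^ k).mulVec v = c ^ k • v := by
    induction k with
    | zero => simp
    | succ k ih => rw [pow_succ', ← Matrix.mulVec_mulVec, ih, Matrix.mulVec_smul, hv, smul_smul,
        pow_succ]
  induction P using Polynomial.induction_on' with
  | add p q hp hq => rw [map_add, map_add, Matrix.add_mulVec, Matrix.add_mulVec, hp, hq]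
  | monomial k a =>
    rw [aeval_monomial, aeval_monomial, hSU.eq, hSU.symm.mul_pow, _root_.smul_pow,
      ← Matrix.mulVec_mulVec, ← Matrix.mulVec_mulVec, ← Matrix.mulVec_mulVec, hpow,
      Matrix.mulVec_smul, Matrix.smul_mulVec]

theorem ext_mulVec_col {R : Type*} [CommRing R] {n p : ℕ} (Q : GL (Fin n) R)
    {M N : Matrix (Fin p) (Fin n) R}
    (h : ∀ i, M.mulVec (Q.val.col i) = N.mulVec (Q.val.col i)) : M = N := by
  have hQ : M * Q.val = N * Q.val := by
    ext i j
    exact congrFun (h j) i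
  simpa [Matrix.mul_assoc] using congrArg (· * Q⁻¹.val) hQ

section ConjDiag

variable {n p : ℕ} (Q : GL (Fin n) ℂ) (c d : Fin n → ℂˣ)

theorem inv_mulVec_conjDiag_mulVec (v : Fin n → ℂ) (i : Fin n) :
    Q⁻¹.val.mulVec ((conjDiag Q c).mulVec v) i = c i * Q⁻¹.val.mulVec v i := by
  rw [conjDiag, Matrix.mulVec_mulVec, ← Matrix.mul_assoc, ← Matrix.mul_assoc, Units.inv_mul,
    Matrix.one_mul, ← Matrix.mulVec_mulVec, Matrix.mulVec_diagonal]

theorem inv_mulVec_injective : Function.Injective Q⁻¹.val.mulVec :=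
  Function.LeftInverse.injective (g := Q.val.mulVec) fun v => by
    rw [Matrix.mulVec_mulVec, Units.mul_inv, Matrix.one_mulVec]

theorem conjDiag_mulVec_col (i : Fin n) :
    (conjDiag Q c).mulVec (Q.val.col i) = (c i : ℂ) • Q.val.col i := by
  rw [← Matrix.mulVec_single_one, conjDiag, Matrix.mulVec_mulVec, Matrix.mul_assoc, Units.inv_mul,
    Matrix.mul_one, ← Matrix.mulVec_mulVec, Matrix.diagonal_mulVec_single, ← Matrix.mulVec_smul,
    ← Pi.single_smul, smul_eq_mul]

theorem conjDiag_mul : conjDiag Q c * conjDiag Q d = conjDiag Q (c * d) :=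
  ext_mulVec_col Q fun i => by
    rw [← Matrix.mulVec_mulVec, conjDiag_mulVec_col, Matrix.mulVec_smul, conjDiag_mulVec_col,
      conjDiag_mulVec_col, smul_smul, mul_comm, Pi.mul_apply, Units.val_mul]

theorem conjDiag_const (a : ℂˣ) : conjDiag Q (fun _ => a) = (a : ℂ) • 1 :=
  ext_mulVec_col Q fun i => by
    rw [conjDiag_mulVec_col, Matrix.smul_mulVec, Matrix.one_mulVec]

theorem conjDiag_one : conjDiag Q 1 = 1 :=
  (conjDiag_const Q 1).trans (one_smul ℂ 1)

variable {Q c d}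

theorem conjDiag_mulVec_of_mulVec_eq_smul {a : ℂˣ} {v : Fin n → ℂ}
    (hv : (conjDiag Q c).mulVec v = (a : ℂ) • v) (f : ℂˣ → ℂˣ) :
    (conjDiag Q fun i => f (c i)).mulVec v = (f a : ℂ) • v := by
  refine inv_mulVec_injective Q (funext fun i => ?_)
  rw [inv_mulVec_conjDiag_mulVec, Matrix.mulVec_smul, Pi.smul_apply, smul_eq_mul]
  by_cases hi : Q⁻¹.val.mulVec v i = 0
  · rw [hi, mul_zero, mul_zero]
  · have hci := inv_mulVec_conjDiag_mulVec Q c v i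
    rw [hv, Matrix.mulVec_smul, Pi.smul_apply, smul_eq_mul, mul_left_inj' hi, Units.val_inj] at hci
    rw [hci]

theorem conjDiag_mulVec_mulVec_col {U : Matrix (Fin n) (Fin n) ℂ} (hU : Commute (conjDiag Q c) U)
    (i : Fin n) : (conjDiag Q c).mulVec (U.mulVec (Q.val.col i)) =
      (c i : ℂ) • U.mulVec (Q.val.col i) := by
  rw [Matrix.mulVec_mulVec, hU.eq, ← Matrix.mulVec_mulVec, conjDiag_mulVec_col, Matrix.mulVec_smul]

theorem commute_conjDiag_comp {U : Matrix (Fin n) (Fin n) ℂ} (hU : Commute (conjDiag Q c) U)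
    (f : ℂˣ → ℂˣ) : Commute (conjDiag Q fun i => f (c i)) U :=
  ext_mulVec_col Q fun i => by
    rw [← Matrix.mulVec_mulVec, ← Matrix.mulVec_mulVec, conjDiag_mulVec_col, Matrix.mulVec_smul,
      conjDiag_mulVec_of_mulVec_eq_smul (conjDiag_mulVec_mulVec_col hU i)]

end ConjDiag

/-! ### The matrices `A^{(γ,λ)}` -/

/-- `IsInterpolant g N P c` says that modulo `(X - c) ^ N` the polynomial `P` is the truncated
binomial series of `γ(c) (c⁻¹ X) ^ λ` at `X = c`, where `g = (γ, λ)`. If this holds at all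
eigenvalues `c` of `A`, and `N` is at least the size of `A`, then `P(A) = A^{(γ,λ)}`. -/
def IsInterpolant (g : Zalg) (N : ℕ) (P : ℂ[X]) (c : ℂˣ) : Prop :=
  (X - C (c : ℂ)) ^ N ∣ P - (g.1 c : ℂ) •
    (PowerSeries.trunc N (PowerSeries.binomialSeries ℂ (Multiplicative.toAdd g.2))).comp
      (C (c : ℂ)⁻¹ * X - 1)

theorem exists_isInterpolant (g : Zalg) (N : ℕ) (s : Finset ℂˣ) :
    ∃ P, ∀ c ∈ s, IsInterpolant g N P c := by
  classical
  let localPoly (c : ℂ) : ℂ[X] := if hc : c = 0 then 0 else (g.1 (Units.mk0 c hc) : ℂ) •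
    (PowerSeries.trunc N (PowerSeries.binomialSeries ℂ (Multiplicative.toAdd g.2))).comp
      (C c⁻¹ * X - 1)
  obtain ⟨P, hP⟩ := exists_forall_X_sub_C_pow_dvd_sub (s.image Units.val) N localPoly
  refine ⟨P, fun c hc => ?_⟩
  simpa [localPoly, IsInterpolant] using hP c (Finset.mem_image_of_mem _ hc)

section Incarnation

variable {g : Zalg} {n p : ℕ}

theorem IsInterpolant.aeval_smul {N : ℕ} {P : ℂ[X]} {c : ℂˣ} (hP : IsInterpolant g N P c)
    (hN : n ≤ N) {U : Matrix (Fin n) (Fin n) ℂ} (hU : IsNilpotent (U - 1)) :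
    aeval ((c : ℂ) • U) P = (g.1 c : ℂ) • unipotentPow U (Multiplicative.toAdd g.2) := by
  obtain ⟨r, hr⟩ := hP
  have hroot : aeval ((c : ℂ) • U) ((X - C (c : ℂ)) ^ N) = 0 := by
    have hbase : aeval ((c : ℂ) • U) (X - C (c : ℂ)) = (c : ℂ) • (U - 1) := by
      rw [map_sub, aeval_X, aeval_C, Algebra.algebraMap_eq_smul_one, smul_sub]
    rw [map_pow, hbase, _root_.smul_pow,
      pow_eq_zero_of_le hN (pow_eq_zero_of_isNilpotent_matrix hU), smul_zero]
  have hshift : aeval ((c : ℂ) • U) (C (c : ℂ)⁻¹ * X - 1) = U - 1 := by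
    rw [map_sub, map_one, ← smul_eq_C_mul, map_smul, aeval_X, smul_smul,
      inv_mul_cancel₀ c.ne_zero, one_smul]
  rw [unipotentPow_eq_aeval hU _ hN, ← hshift, ← aeval_comp, ← map_smul, ← sub_eq_zero, ← map_sub,
    hr, map_mul, hroot, zero_mul]

theorem aeval_conjDiag_mul {N : ℕ} (hN : n ≤ N) {P : ℂ[X]} {Q : GL (Fin n) ℂ} {c : Fin n → ℂˣ}
    {U : Matrix (Fin n) (Fin n) ℂ} (hU : IsNilpotent (U - 1)) (hQU : Commute (conjDiag Q c) U)
    (hP : ∀ i, IsInterpolant g N P (c i)) :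
    aeval (conjDiag Q c * U) P =
      conjDiag Q (fun i => g.1 (c i)) * unipotentPow U (Multiplicative.toAdd g.2) :=
  ext_mulVec_col Q fun i => by
    rw [aeval_mul_mulVec_of_mulVec_eq_smul hQU (conjDiag_mulVec_col Q c i),
      (hP i).aeval_smul hN hU, Matrix.smul_mulVec, ← Matrix.mulVec_mulVec,
      conjDiag_mulVec_of_mulVec_eq_smul
        (conjDiag_mulVec_mulVec_col (commute_unipotentPow hQU _) i)]

theorem aeval_mul_eq_mul_aeval {R : Type*} [CommRing R] {A : Matrix (Fin n) (Fin n) R}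
    {B : Matrix (Fin p) (Fin p) R} {F : Matrix (Fin p) (Fin n) R} (h : F * A = B * F) (P : R[X]) :
    F * aeval A P = aeval B P * F := by
  have hpow (k : ℕ) : F * A ^ k = B ^ k * F := by
    induction k with
    | zero => simp
    | succ k ih => rw [pow_succ, ← Matrix.mul_assoc, ih, Matrix.mul_assoc, h, ← Matrix.mul_assoc,
        pow_succ]
  induction P using Polynomial.induction_on' with
  | add p q hp hq => rw [map_add, map_add, Matrix.mul_add, Matrix.add_mul, hp, hq]
  | monomial k a => simp only [aeval_monomial, Algebra.algebraMap_eq_smul_one, smul_mul_assoc,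
      one_mul, Matrix.mul_smul, Matrix.smul_mul, hpow]

theorem IsIncarnation.intertwine {A : GL (Fin n) ℂ} {B : GL (Fin p) ℂ}
    {M : Matrix (Fin n) (Fin n) ℂ} {N : Matrix (Fin p) (Fin p) ℂ} (hM : IsIncarnation g A M)
    (hN : IsIncarnation g B N) {F : Matrix (Fin p) (Fin n) ℂ} (h : F * A.val = B.val * F) :
    F * M = N * F := by
  classical
  obtain ⟨Q, c, U, hU, hQU, hA, rfl⟩ := hM
  obtain ⟨R, d, V, hV, hRV, hB, rfl⟩ := hN
  obtain ⟨P, hP⟩ := exists_isInterpolant g (max n p)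
    (Finset.univ.image c ∪ Finset.univ.image d)
  rw [← aeval_conjDiag_mul (le_max_left n p) hU hQU fun i => hP _ (by simp),
    ← aeval_conjDiag_mul (le_max_right n p) hV hRV fun i => hP _ (by simp), ← hA, ← hB,
    aeval_mul_eq_mul_aeval h]

theorem IsIncarnation.unique {A : GL (Fin n) ℂ} {M N : Matrix (Fin n) (Fin n) ℂ}
    (hM : IsIncarnation g A M) (hN : IsIncarnation g A N) : M = N := by
  simpa using hM.intertwine hN (F := 1) (by simp)

end Incarnation

/-! ### Existence of the multiplicative Dunford decomposition -/

section Dunford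

variable {K V : Type*} [Field K] [IsAlgClosed K] [AddCommGroup V] [Module K V]
  [FiniteDimensional K V] {n : ℕ}

theorem exists_basis_eigenvectors (hn : Module.finrank K V = n) {s : Module.End K V}
    (hs : s.IsSemisimple) :
    ∃ (b : Module.Basis (Fin n) K V) (μ : Fin n → K), ∀ i, s (b i) = μ i • b i := by
  classical
  have hint : DirectSum.IsInternal fun μ : K => s.eigenspace μ :=
    DirectSum.isInternal_submodule_of_iSupIndep_of_iSup_eq_top s.eigenspaces_iSupIndep
      hs.iSup_eigenspace_eq_top
  let b := hint.collectedBasis fun μ => Module.finBasis K (s.eigenspace μ)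
  let _ : Fintype (Σ μ : K, Fin (Module.finrank K (s.eigenspace μ))) :=
    FiniteDimensional.fintypeBasisIndex b
  let e := Fintype.equivFinOfCardEq ((Module.finrank_eq_card_basis b).symm.trans hn)
  refine ⟨b.reindex e, fun i => (e.symm i).1, fun i => ?_⟩
  rw [Module.Basis.reindex_apply]
  exact Module.End.mem_eigenspace_iff.mp (hint.collectedBasis_mem _ _)

theorem exists_toMatrix'_eq_conj_diagonal {s : Module.End K (Fin n → K)} (hs : s.IsSemisimple) :
    ∃ (Q : GL (Fin n) K) (μ : Fin n → K),
      LinearMap.toMatrix' s = Q.val * Matrix.diagonal μ * Q⁻¹.val := by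
  obtain ⟨b, μ, hb⟩ := exists_basis_eigenvectors (Module.finrank_fin_fun K) hs
  let Q : GL (Fin n) K :=
    { val := (Pi.basisFun K (Fin n)).toMatrix b
      inv := b.toMatrix (Pi.basisFun K (Fin n))
      val_inv := Module.Basis.toMatrix_mul_toMatrix_flip _ _
      inv_val := Module.Basis.toMatrix_mul_toMatrix_flip _ _ }
  have hcol (j : Fin n) : Q.val.col j = b j := by
    ext i
    simp [Q, Module.Basis.toMatrix_apply]
  refine ⟨Q, μ, ext_mulVec_col Q fun i => ?_⟩
  rw [LinearMap.toMatrix'_mulVec, hcol, hb, ← hcol, ← Matrix.mulVec_single_one,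
    Matrix.mulVec_mulVec, Matrix.mul_assoc, Units.inv_mul, Matrix.mul_one, ← Matrix.mulVec_mulVec,
    Matrix.diagonal_mulVec_single, ← Matrix.mulVec_smul, ← Pi.single_smul, smul_eq_mul]

theorem exists_isNilpotent_add_conj_diagonal (A : Matrix (Fin n) (Fin n) K) :
    ∃ (N : Matrix (Fin n) (Fin n) K) (Q : GL (Fin n) K) (μ : Fin n → K), IsNilpotent N ∧
      Commute N (Q.val * Matrix.diagonal μ * Q⁻¹.val) ∧
      A = N + Q.val * Matrix.diagonal μ * Q⁻¹.val := by
  obtain ⟨t, ht, s, hs, htnil, hsemi, hts⟩ :=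
    Module.End.exists_isNilpotent_isSemisimple (f := Matrix.toLin' A)
  have hcomm : Commute t s := Algebra.commute_of_mem_adjoin_singleton_of_commute hs
    (Algebra.commute_of_mem_adjoin_self ht).symm
  obtain ⟨Q, μ, hQ⟩ := exists_toMatrix'_eq_conj_diagonal hsemi
  refine ⟨LinearMap.toMatrixAlgEquiv' t, Q, μ, htnil.map _, ?_, ?_⟩
  · rw [← hQ]
    exact hcomm.map LinearMap.toMatrixAlgEquiv'
  · rw [← hQ, ← LinearMap.toMatrix'_toLin' A, hts, map_add]
    rfl

theorem exists_dunford (A : GL (Fin n) ℂ) :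
    ∃ (Q : GL (Fin n) ℂ) (c : Fin n → ℂˣ) (U : Matrix (Fin n) (Fin n) ℂ),
      IsNilpotent (U - 1) ∧ Commute (conjDiag Q c) U ∧ A.val = conjDiag Q c * U := by
  obtain ⟨N, Q, μ, hN, hNS, hA⟩ := exists_isNilpotent_add_conj_diagonal A.val
  have hNA : Commute N A.val := hA ▸ (Commute.refl N).add_right hNS
  obtain ⟨S, hS⟩ : IsUnit (Q.val * Matrix.diagonal μ * Q⁻¹.val) := by
    rw [← neg_add_cancel_left N (_ * _), ← hA]
    exact hN.neg.isUnit_add_right_of_commute A.isUnit hNA.neg_left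
  rw [← hS] at hNS hA
  have hμ (i : Fin n) : μ i ≠ 0 := by
    have hdet : S.val.det = ∏ i, μ i := by rw [hS, Matrix.det_units_conj, Matrix.det_diagonal]
    have hprod : ∏ i, μ i ≠ 0 := hdet ▸ ((Matrix.isUnit_iff_isUnit_det _).mp S.isUnit).ne_zero
    exact Finset.prod_ne_zero_iff.mp hprod i (Finset.mem_univ i)
  have hSQ : conjDiag Q (fun i => Units.mk0 (μ i) (hμ i)) = S.val := hS.symm
  have hNS' : Commute (S⁻¹).val N := hNS.units_inv_right.symm
  refine ⟨Q, fun i => Units.mk0 (μ i) (hμ i), S⁻¹.val * A.val, ?_, ?_, ?_⟩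
  · rw [hA, mul_add, Units.inv_mul, add_sub_cancel_right]
    exact hNS'.isNilpotent_mul_left hN
  · rw [hSQ, hA]
    exact (Commute.units_inv_right (Commute.refl S.val)).mul_right
      (hNS.symm.add_right (Commute.refl S.val))
  · rw [hSQ, Units.mul_inv_cancel_left]

end Dunford

/-! ### The action of `ℤ^alg` on invertible matrices -/

section Incarnation

variable (g h : Zalg) {n p : ℕ} (A : GL (Fin n) ℂ) (B : GL (Fin p) ℂ)

theorem exists_isIncarnation : ∃ M, IsIncarnation g A M := by
  obtain ⟨Q, c, U, hU, hQU, hA⟩ := exists_dunford A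
  exact ⟨_, Q, c, U, hU, hQU, hA, rfl⟩

/-- The matrix `A^{(γ,λ)}`, for `g = (γ,λ)`. -/
def incarnation : Matrix (Fin n) (Fin n) ℂ :=
  (exists_isIncarnation g A).choose

theorem isIncarnation_incarnation : IsIncarnation g A (incarnation g A) :=
  (exists_isIncarnation g A).choose_spec

variable {g A B} in
theorem IsIncarnation.eq {M : Matrix (Fin n) (Fin n) ℂ} (hM : IsIncarnation g A M) :
    incarnation g A = M :=
  (isIncarnation_incarnation g A).unique hM

theorem incarnation_eq_iff (M : Matrix (Fin n) (Fin n) ℂ) :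
    incarnation g A = M ↔ IsIncarnation g A M :=
  ⟨fun hM => hM ▸ isIncarnation_incarnation g A, IsIncarnation.eq⟩

variable {A B} in
theorem incarnation_intertwine {F : Matrix (Fin p) (Fin n) ℂ} (hF : F * A.val = B.val * F) :
    F * incarnation g A = incarnation g B * F :=
  (isIncarnation_incarnation g A).intertwine (isIncarnation_incarnation g B) hF

theorem incarnation_mul : incarnation (g * h) A = incarnation g A * incarnation h A := by
  obtain ⟨Q, c, U, hU, hQU, hA⟩ := exists_dunford A
  have hcomm := commute_unipotentPow (commute_conjDiag_comp hQU h.1) (Multiplicative.toAdd g.2)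
  rw [IsIncarnation.eq ⟨Q, c, U, hU, hQU, hA, rfl⟩,
    IsIncarnation.eq (g := g) ⟨Q, c, U, hU, hQU, hA, rfl⟩,
    IsIncarnation.eq (g := h) ⟨Q, c, U, hU, hQU, hA, rfl⟩, hcomm.symm.mul_mul_mul_comm,
    conjDiag_mul, ← unipotentPow_add hU]
  rfl

theorem incarnation_one : incarnation 1 A = 1 := by
  obtain ⟨Q, c, U, hU, hQU, hA⟩ := exists_dunford A
  refine IsIncarnation.eq ⟨Q, c, U, hU, hQU, hA, ?_⟩
  have hS : conjDiag Q (fun i => (1 : Zalg).1 (c i)) = 1 := conjDiag_one Q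
  have hUpow : unipotentPow U (Multiplicative.toAdd (1 : Zalg).2) = 1 := unipotentPow_zero hU
  rw [hS, hUpow, one_mul]

/-- `A^{(γ,λ)}` as an invertible matrix. -/
def incarnationGL : GL (Fin n) ℂ where
  val := incarnation g A
  inv := incarnation g⁻¹ A
  val_inv := by rw [← incarnation_mul, mul_inv_cancel (G := Zalg), incarnation_one]
  inv_val := by rw [← incarnation_mul, inv_mul_cancel (G := Zalg), incarnation_one]

variable {g A} in
theorem incarnation_smul {A' : GL (Fin n) ℂ} (a : ℂˣ) (hA' : A'.val = (a : ℂ) • A.val) :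
    incarnation g A' = (g.1 a : ℂ) • incarnation g A := by
  obtain ⟨Q, c, U, hU, hQU, hA⟩ := exists_dunford A
  have hsmul (a : ℂˣ) (c : Fin n → ℂˣ) :
      conjDiag Q (fun i => a * c i) = (a : ℂ) • conjDiag Q c := by
    rw [← one_mul (conjDiag Q c), ← smul_mul_assoc, ← conjDiag_const Q a, conjDiag_mul]
    rfl
  rw [IsIncarnation.eq (g := g) (A := A) ⟨Q, c, U, hU, hQU, hA, rfl⟩]
  refine IsIncarnation.eq ⟨Q, fun i => a * c i, U, hU, ?_, ?_, ?_⟩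
  · rw [hsmul]
    exact hQU.smul_left _
  · rw [hA', hA, hsmul, Matrix.smul_mul]
  · simp only [map_mul]
    rw [hsmul, Matrix.smul_mul]

variable {A} in
theorem incarnation_of_isNilpotent_sub_one (hA : IsNilpotent (A.val - 1)) :
    incarnation g A = unipotentPow A.val (Multiplicative.toAdd g.2) := by
  refine IsIncarnation.eq ⟨1, 1, A.val, hA, ?_, ?_, ?_⟩
  · rw [conjDiag_one]
    exact Commute.one_left _
  · rw [conjDiag_one, one_mul]
  · simp only [Pi.one_apply, map_one]
    rw [← Pi.one_def, conjDiag_one, one_mul]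

theorem incarnation_one_right : incarnation g (1 : GL (Fin n) ℂ) = 1 := by
  rw [incarnation_of_isNilpotent_sub_one g (by simp), Units.val_one, unipotentPow_one_left]

/-- The invertible matrix `(c)` of size one. -/
def rankOneGL (c : ℂˣ) : GL (Fin 1) ℂ := Units.map (Matrix.scalar (Fin 1)).toMonoidHom c

theorem rankOneGL_apply (c : ℂˣ) : (rankOneGL c).val 0 0 = c := by
  simp [rankOneGL]

theorem incarnation_rankOneGL (c : ℂˣ) : incarnation g (rankOneGL c) 0 0 = g.1 c := by
  have hc : (rankOneGL c).val = (c : ℂ) • (1 : GL (Fin 1) ℂ).val := by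
    simp [rankOneGL, Matrix.smul_one_eq_diagonal]
  rw [incarnation_smul c hc, incarnation_one_right]
  simp

/-- The invertible matrix `(1 1; 0 1)`. -/
def jordanTwo : GL (Fin 2) ℂ where
  val := !![1, 1; 0, 1]
  inv := !![1, -1; 0, 1]
  val_inv := by simp [Matrix.one_fin_two]
  inv_val := by simp [Matrix.one_fin_two]

theorem jordanTwo_sub_one : jordanTwo.val - 1 = !![0, 1; 0, 0] := by
  ext i j
  fin_cases i <;> fin_cases j <;> simp [jordanTwo]

theorem incarnation_jordanTwo : incarnation g jordanTwo 0 1 = Multiplicative.toAdd g.2 := by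
  have hnil : IsNilpotent (jordanTwo.val - 1) :=
    ⟨2, by
      rw [jordanTwo_sub_one, pow_two, Matrix.mul_fin_two]
      ext i j
      fin_cases i <;> fin_cases j <;> simp⟩
  rw [incarnation_of_isNilpotent_sub_one g hnil, unipotentPow, jordanTwo_sub_one,
    Finset.sum_range_succ, Finset.sum_range_one, Ring.choose_zero_right, Ring.choose_one_right]
  simp

/-- The Kronecker product of invertible matrices. -/
def kronGL : GL (Fin (n * p)) ℂ where
  val := kron A.val B.val
  inv := kron A⁻¹.val B⁻¹.val
  val_inv := by rw [kron_mul, Units.mul_inv, Units.mul_inv, kron_one]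
  inv_val := by rw [kron_mul, Units.inv_mul, Units.inv_mul, kron_one]

theorem conjDiag_kronGL (Q : GL (Fin n) ℂ) (c : Fin n → ℂˣ) (R : GL (Fin p) ℂ)
    (d : Fin p → ℂˣ) :
    conjDiag (kronGL Q R)
        (fun k => c ((pairEquiv n p).symm k).1 * d ((pairEquiv n p).symm k).2) =
      kron (conjDiag Q c) (conjDiag R d) := by
  have hdiag : Matrix.diagonal (fun k : Fin (n * p) =>
      ((c ((pairEquiv n p).symm k).1 * d ((pairEquiv n p).symm k).2 : ℂˣ) : ℂ)) =
      kron (Matrix.diagonal fun i => (c i : ℂ)) (Matrix.diagonal fun i => (d i : ℂ)) := by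
    ext k l
    obtain ⟨⟨i, j⟩, rfl⟩ := (pairEquiv n p).surjective k
    obtain ⟨⟨i', j'⟩, rfl⟩ := (pairEquiv n p).surjective l
    by_cases hi : i = i' <;> by_cases hj : j = j' <;> simp [kron_apply, hi, hj]
  simp only [conjDiag]
  rw [hdiag, ← kron_mul, ← kron_mul]
  rfl

theorem incarnation_kronGL :
    incarnation g (kronGL A B) = kron (incarnation g A) (incarnation g B) := by
  obtain ⟨Q, c, U, hU, hQU, hA⟩ := exists_dunford A
  obtain ⟨R, d, V, hV, hRV, hB⟩ := exists_dunford B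
  rw [IsIncarnation.eq (g := g) ⟨Q, c, U, hU, hQU, hA, rfl⟩,
    IsIncarnation.eq (g := g) ⟨R, d, V, hV, hRV, hB, rfl⟩]
  refine IsIncarnation.eq ⟨kronGL Q R,
    fun k => c ((pairEquiv n p).symm k).1 * d ((pairEquiv n p).symm k).2, kron U V,
    isNilpotent_kron_sub_one hU hV, ?_, ?_, ?_⟩
  · rw [conjDiag_kronGL, Commute, SemiconjBy, kron_mul, kron_mul, hQU.eq, hRV.eq]
  · rw [conjDiag_kronGL, kron_mul, ← hA, ← hB]
    rfl
  · simp only [map_mul]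
    rw [conjDiag_kronGL Q (fun i => g.1 (c i)) R (fun i => g.1 (d i)), unipotentPow_kron hU hV,
      kron_mul]

end Incarnation

/-! ### Automorphisms of fibre functors as families of matrices -/

theorem matrix_ext_tmul {n m p : ℕ} {M N : Matrix (Fin p) (Fin (n * m)) ℂ}
    (h : ∀ x y, M.mulVec (tensorPi n m (TensorProduct.tmul ℂ x y)) =
      N.mulVec (tensorPi n m (TensorProduct.tmul ℂ x y))) : M = N := by
  have hlin : M.mulVecLin ∘ₗ (tensorPi n m).toLinearMap =
      N.mulVecLin ∘ₗ (tensorPi n m).toLinearMap := TensorProduct.ext' h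
  refine Matrix.ext_of_mulVec_single fun i => ?_
  rw [← (tensorPi n m).apply_symm_apply (Pi.single i 1)]
  exact LinearMap.congr_fun hlin _

namespace FlatSys

variable {K : Type} [CommRing K] [Algebra ℂ K] {σ : K →+* K} (S : Subring K) (ev : S →+* ℂ)
  (hS : ∀ (X Y : FlatSys K σ) (f : X ⟶ Y) (i : Fin Y.n) (j : Fin X.n), f.F i j ∈ S)

/-- The matrix of the component at `(ℂⁿ, A)` of an automorphism of a fibre functor. For the
forgetful functor of `ℛ`, this is `compMat`. -/
def componentMat (α : Aut (fibre S ev hS)) (X : FlatSys K σ) :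
    Matrix (Fin X.n) (Fin X.n) ℂ :=
  LinearMap.toMatrix' (m := Fin X.n) (n := Fin X.n) (α.hom.app X).hom.hom

variable {S ev hS} {α β : Aut (fibre S ev hS)}

theorem componentMat_mulVec (α : Aut (fibre S ev hS)) (X : FlatSys K σ) (x : Fin X.n → ℂ) :
    (componentMat S ev hS α X).mulVec x = (α.hom.app X).hom.hom x :=
  LinearMap.toMatrix'_mulVec (m := Fin X.n) (n := Fin X.n) (α.hom.app X).hom.hom x

theorem aut_ext (h : ∀ X, componentMat S ev hS α X = componentMat S ev hS β X) : α = β := by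
  apply Iso.ext
  ext X : 2
  exact FGModuleCat.hom_ext (LinearMap.toMatrix'.injective (h X))

theorem componentMat_one (X : FlatSys K σ) : componentMat S ev hS 1 X = 1 :=
  LinearMap.toMatrix'_id (n := Fin X.n)

theorem componentMat_mul (α β : Aut (fibre S ev hS)) (X : FlatSys K σ) :
    componentMat S ev hS (α * β) X = componentMat S ev hS α X * componentMat S ev hS β X :=
  LinearMap.toMatrix'_comp (l := Fin X.n) (m := Fin X.n) (n := Fin X.n) (α.hom.app X).hom.hom
    (β.hom.app X).hom.hom

theorem evMat_mul_componentMat (α : Aut (fibre S ev hS)) {X Y : FlatSys K σ} (f : X ⟶ Y) :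
    evMat S ev hS f * componentMat S ev hS α X = componentMat S ev hS α Y * evMat S ev hS f := by
  refine Matrix.ext_iff_mulVec.mpr fun x => ?_
  rw [← Matrix.mulVec_mulVec, ← Matrix.mulVec_mulVec, componentMat_mulVec, componentMat_mulVec]
  exact congrArg (fun φ => φ.hom.hom x) (α.hom.naturality f).symm

theorem componentMat_unit (hα : α ∈ AutTensor (fibre S ev hS)) :
    componentMat S ev hS α (𝟙_ (FlatSys K σ)) = (1 : Matrix (Fin 1) (Fin 1) ℂ) := by
  refine (Matrix.ext_iff_mulVec (m := Fin 1) (n := Fin 1)).mpr fun x => ?_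
  obtain ⟨c, rfl⟩ := (LinearEquiv.funUnique (Fin 1) ℂ ℂ).symm.surjective x
  rw [Matrix.one_mulVec]
  exact (componentMat_mulVec α _ _).trans (congrArg (fun φ => φ.hom.hom c) hα.unit)

theorem componentMat_tensor (hα : α ∈ AutTensor (fibre S ev hS)) (X Y : FlatSys K σ) :
    componentMat S ev hS α (X ⊗ Y) =
      kron (componentMat S ev hS α X) (componentMat S ev hS α Y) := by
  refine matrix_ext_tmul (n := X.n) (m := Y.n) (p := X.n * Y.n) fun x y => ?_
  rw [kron_mulVec, componentMat_mulVec, componentMat_mulVec]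
  exact (componentMat_mulVec α (X ⊗ Y) _).trans
    (congrArg (fun φ => φ.hom.hom (TensorProduct.tmul ℂ x y)) (hα.tensor X Y))

variable (S ev hS)

/-- The automorphism of a fibre functor given by a natural family of invertible matrices. -/
def autOfMatrices (M : ∀ X : FlatSys K σ, GL (Fin X.n) ℂ)
    (hM : ∀ (X Y : FlatSys K σ) (f : X ⟶ Y),
      evMat S ev hS f * (M X).val = (M Y).val * evMat S ev hS f) :
    Aut (fibre S ev hS) :=
  NatIso.ofComponents
    (fun X => (Matrix.toLin'OfInv (M X).inv_mul (M X).mul_inv).toFGModuleCatIso)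
    fun {X Y} f => by
      refine FGModuleCat.hom_ext (LinearMap.ext fun (x : Fin X.n → ℂ) => ?_)
      change (M Y).val.mulVec ((evMat S ev hS f).mulVec x) =
        (evMat S ev hS f).mulVec ((M X).val.mulVec x)
      rw [Matrix.mulVec_mulVec, Matrix.mulVec_mulVec, hM]

/-- The tensor automorphism of a fibre functor given by a family of invertible matrices that is
natural and compatible with the tensor product. -/
def tensorAutOfMatrices (M : ∀ X : FlatSys K σ, GL (Fin X.n) ℂ)
    (hM : ∀ (X Y : FlatSys K σ) (f : X ⟶ Y),
      evMat S ev hS f * (M X).val = (M Y).val * evMat S ev hS f)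
    (hunit : (M (𝟙_ (FlatSys K σ))).val = (1 : Matrix (Fin 1) (Fin 1) ℂ))
    (htensor : ∀ X Y : FlatSys K σ, (M (X ⊗ Y)).val = kron (M X).val (M Y).val) :
    AutTensor (fibre S ev hS) where
  val := autOfMatrices S ev hS M hM
  property :=
    { unit := by
        refine FGModuleCat.hom_ext (LinearMap.ext fun (c : ℂ) => ?_)
        change (M (𝟙_ (FlatSys K σ))).val.mulVec ((LinearEquiv.funUnique (Fin 1) ℂ ℂ).symm c) =
          (LinearEquiv.funUnique (Fin 1) ℂ ℂ).symm c
        rw [hunit]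
        exact Matrix.one_mulVec _
      tensor := fun X Y => by
        refine FGModuleCat.hom_ext (TensorProduct.ext' fun x y => ?_)
        change (M (X ⊗ Y)).val.mulVec (tensorPi X.n Y.n (TensorProduct.tmul ℂ x y)) =
          tensorPi X.n Y.n (TensorProduct.tmul ℂ ((M X).val.mulVec x) ((M Y).val.mulVec y))
        rw [htensor]
        exact kron_mulVec _ _ x y }

end FlatSys

/-! ### The homomorphism `ℤ^alg → Aut^⊗(ω)` -/

/-- The tensor automorphism `(ℂⁿ, A) ↦ A^{(γ,λ)}` of the forgetful functor. -/
def autOfZalg (g : Zalg) : AutTensor forgetR :=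
  FlatSys.tensorAutOfMatrices _ _ _ (fun X => incarnationGL g X.A)
    (fun _ _ f => incarnation_intertwine g f.comm) (incarnation_one_right g)
    fun X Y => incarnation_kronGL g X.A Y.A

theorem compMat_autOfZalg (g : Zalg) (X : RepZ) :
    compMat (autOfZalg g).1 X = incarnation g X.A :=
  LinearMap.toMatrix'_toLin' (incarnation g X.A)

/-- The homomorphism `ℤ^alg → Aut^⊗(ω)`, `(γ,λ) ↦ ((ℂⁿ, A) ↦ A^{(γ,λ)})`. -/
def zalgHom : Zalg →* AutTensor forgetR where
  toFun := autOfZalg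
  map_one' := Subtype.ext (FlatSys.aut_ext fun X =>
    (compMat_autOfZalg 1 X).trans ((incarnation_one X.A).trans (FlatSys.componentMat_one X).symm))
  map_mul' g h := Subtype.ext (FlatSys.aut_ext fun X => by
    refine (compMat_autOfZalg (g * h) X).trans ?_
    rw [incarnation_mul, ← compMat_autOfZalg, ← compMat_autOfZalg]
    exact (FlatSys.componentMat_mul _ _ X).symm)

theorem zalgHom_injective : Function.Injective zalgHom := by
  intro g h hgh
  have hA {n : ℕ} (A : GL (Fin n) ℂ) : incarnation g A = incarnation h A := by
    rw [← compMat_autOfZalg g ⟨n, A⟩, ← compMat_autOfZalg h ⟨n, A⟩]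
    exact congrArg (fun α : AutTensor forgetR => compMat α.1 ⟨n, A⟩) hgh
  refine Prod.ext (MonoidHom.ext fun c => Units.ext ?_) (Multiplicative.toAdd.injective ?_)
  · rw [← incarnation_rankOneGL, ← incarnation_rankOneGL, hA]
  · rw [← incarnation_jordanTwo, ← incarnation_jordanTwo, hA]

/-! ### The action of an automorphism of `ω` on linear automorphisms -/

section Action

variable {V W : Type*} [AddCommGroup V] [Module ℂ V] [AddCommGroup W] [Module ℂ W] {n p : ℕ}

/-- The invertible matrix of a linear automorphism in a basis. -/
def basisGL (b : Module.Basis (Fin n) ℂ V) (T : (Module.End ℂ V)ˣ) : GL (Fin n) ℂ :=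
  Units.map (LinearMap.toMatrixAlgEquiv b : Module.End ℂ V →* Matrix (Fin n) (Fin n) ℂ) T

theorem toMatrix_mul_compMat (α : Aut forgetR) (b : Module.Basis (Fin n) ℂ V)
    (b' : Module.Basis (Fin p) ℂ W) {T : (Module.End ℂ V)ˣ} {S : (Module.End ℂ W)ˣ}
    {L : V →ₗ[ℂ] W} (hL : L ∘ₗ T.val = S.val ∘ₗ L) :
    LinearMap.toMatrix b b' L * compMat α ⟨n, basisGL b T⟩ =
      compMat α ⟨p, basisGL b' S⟩ * LinearMap.toMatrix b b' L :=
  FlatSys.evMat_mul_componentMat α (X := ⟨n, basisGL b T⟩) (Y := ⟨p, basisGL b' S⟩)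
    { F := LinearMap.toMatrix b b' L
      comm := (LinearMap.toMatrix_comp b b b' L T.val).symm.trans
        ((congrArg _ hL).trans (LinearMap.toMatrix_comp b b' b' S.val L)) }

/-- The linear automorphism of `ℂⁿ` given by an invertible matrix. -/
def endOfGL (A : GL (Fin n) ℂ) : (Module.End ℂ (Fin n → ℂ))ˣ := Matrix.GeneralLinearGroup.toLin A

theorem endOfGL_pow_apply (A : GL (Fin n) ℂ) (m : ℕ) (v : Fin n → ℂ) :
    ((endOfGL A).val ^ m) v = (A.val ^ m).mulVec v :=
  LinearMap.congr_fun (Matrix.toLin'_pow A.val m).symm v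

/-- The direct sum of two linear automorphisms. -/
def prodEnd (T : (Module.End ℂ V)ˣ) (S : (Module.End ℂ W)ˣ) : (Module.End ℂ (V × W))ˣ :=
  Units.map (LinearMap.prodMapRingHom ℂ V W : _ →* Module.End ℂ (V × W))
    (MulEquiv.prodUnits.symm (T, S))

theorem prodEnd_pow_apply (T : (Module.End ℂ V)ˣ) (S : (Module.End ℂ W)ˣ) (m : ℕ) (v : V)
    (w : W) : ((prodEnd T S).val ^ m) (v, w) = ((T.val ^ m) v, (S.val ^ m) w) :=
  LinearMap.congr_fun (map_pow (LinearMap.prodMapRingHom ℂ V W) (T.val, S.val) m).symm (v, w)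

variable [FiniteDimensional ℂ V] [FiniteDimensional ℂ W]

/-- The component of an automorphism of `ω` at the representation `(V, T)` of `ℤ`, for an arbitrary
finite-dimensional space `V`. -/
def action (α : Aut forgetR) (T : (Module.End ℂ V)ˣ) : Module.End ℂ V :=
  (LinearMap.toMatrixAlgEquiv (Module.finBasis ℂ V)).symm
    (compMat α ⟨_, basisGL (Module.finBasis ℂ V) T⟩)

theorem toMatrix_action (α : Aut forgetR) (b : Module.Basis (Fin n) ℂ V)
    (T : (Module.End ℂ V)ˣ) :
    LinearMap.toMatrix b b (action α T) = compMat α ⟨n, basisGL b T⟩ := by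
  set b₀ := Module.finBasis ℂ V
  have hb₀ : LinearMap.toMatrix b₀ b₀ (action α T) = compMat α ⟨_, basisGL b₀ T⟩ :=
    (LinearMap.toMatrixAlgEquiv b₀).apply_symm_apply _
  have hid := toMatrix_mul_compMat α b₀ b (T := T) (S := T) (L := LinearMap.id) rfl
  calc LinearMap.toMatrix b b (action α T)
      = LinearMap.toMatrix b₀ b LinearMap.id * LinearMap.toMatrix b₀ b₀ (action α T) *
          LinearMap.toMatrix b b₀ LinearMap.id := by
        rw [← LinearMap.toMatrix_comp, ← LinearMap.toMatrix_comp, LinearMap.comp_id,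
          LinearMap.id_comp]
    _ = compMat α ⟨n, basisGL b T⟩ := by
        rw [hb₀, hid, Matrix.mul_assoc, ← LinearMap.toMatrix_comp, LinearMap.comp_id,
          LinearMap.toMatrix_id, Matrix.mul_one]

theorem comp_action (α : Aut forgetR) {T : (Module.End ℂ V)ˣ} {S : (Module.End ℂ W)ˣ}
    {L : V →ₗ[ℂ] W} (hL : L ∘ₗ T.val = S.val ∘ₗ L) : L ∘ₗ action α T = action α S ∘ₗ L := by
  refine (LinearMap.toMatrix (Module.finBasis ℂ V) (Module.finBasis ℂ W)).injective ?_
  rw [LinearMap.toMatrix_comp _ (Module.finBasis ℂ V),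
    LinearMap.toMatrix_comp _ (Module.finBasis ℂ W), toMatrix_action, toMatrix_action,
    toMatrix_mul_compMat α _ _ hL]

theorem action_endOfGL_apply (α : Aut forgetR) (A : GL (Fin n) ℂ) (v : Fin n → ℂ) :
    action α (endOfGL A) v = (compMat α ⟨n, A⟩).mulVec v := by
  have hA : basisGL (Pi.basisFun ℂ (Fin n)) (endOfGL A) = A :=
    Units.ext (LinearMap.toMatrix'_toLin' A.val)
  have hmat := toMatrix_action α (Pi.basisFun ℂ (Fin n)) (endOfGL A)
  rw [hA] at hmat
  rw [← hmat]
  exact (LinearMap.toMatrix'_mulVec _ v).symm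

theorem action_mem {α : Aut forgetR} {T : (Module.End ℂ V)ˣ} {U : Submodule ℂ V}
    (hU : ∀ u ∈ U, T.val u ∈ U) {u : V} (hu : u ∈ U) : action α T u ∈ U := by
  have hT : IsUnit (T.val.restrict hU) := by
    rw [LinearMap.isUnit_iff_ker_eq_bot, LinearMap.ker_eq_bot]
    intro x y hxy
    exact Subtype.ext (((Module.End.isUnit_iff _).mp T.isUnit).injective
      (congrArg Subtype.val hxy))
  obtain ⟨S, hS⟩ := hT
  have hsub : U.subtype ∘ₗ S.val = T.val ∘ₗ U.subtype := by
    rw [hS]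
    rfl
  have hαu : (action α S ⟨u, hu⟩ : V) = action α T u :=
    LinearMap.congr_fun (comp_action α hsub) ⟨u, hu⟩
  exact hαu ▸ Subtype.prop _

theorem action_prodEnd_apply (α : Aut forgetR) (T : (Module.End ℂ V)ˣ) (S : (Module.End ℂ W)ˣ)
    (v : V) (w : W) : action α (prodEnd T S) (v, w) = (action α T v, action α S w) := by
  have hfst : LinearMap.fst ℂ V W ∘ₗ (prodEnd T S).val = T.val ∘ₗ LinearMap.fst ℂ V W := rfl
  have hsnd : LinearMap.snd ℂ V W ∘ₗ (prodEnd T S).val = S.val ∘ₗ LinearMap.snd ℂ V W := rfl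
  exact Prod.ext (LinearMap.congr_fun (comp_action α hfst) (v, w))
    (LinearMap.congr_fun (comp_action α hsnd) (v, w))

end Action

/-! ### Matrix coefficients -/

section Coefficients

variable {α β : Aut forgetR} {x y : (ℕ → ℂ) × ℂ}

/-- The pair `x` consists of a matrix coefficient `m ↦ φ(Aᵐ v)` of a representation of `ℤ` and of
the value `φ(α_A v)` on it of the automorphism `α` of `ω`. -/
def IsCoeff (α : Aut forgetR) (x : (ℕ → ℂ) × ℂ) : Prop :=
  ∃ (n : ℕ) (A : GL (Fin n) ℂ) (φ : (Fin n → ℂ) →ₗ[ℂ] ℂ) (v : Fin n → ℂ),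
    (∀ m : ℕ, φ ((A.val ^ m).mulVec v) = x.1 m) ∧ φ ((compMat α ⟨n, A⟩).mulVec v) = x.2

theorem isCoeff_action {V : Type*} [AddCommGroup V] [Module ℂ V] [FiniteDimensional ℂ V]
    (α : Aut forgetR) (T : (Module.End ℂ V)ˣ) (φ : V →ₗ[ℂ] ℂ) (v : V) :
    IsCoeff α (fun m => φ ((T.val ^ m) v), φ (action α T v)) := by
  set b := Module.finBasis ℂ V
  have happly (L : Module.End ℂ V) :
      b.equivFun.symm ((LinearMap.toMatrix b b L).mulVec (b.equivFun v)) = L v :=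
    b.equivFun.symm_apply_eq.mpr (LinearMap.toMatrix_mulVec_repr b b L v)
  refine ⟨_, basisGL b T, φ ∘ₗ b.equivFun.symm.toLinearMap, b.equivFun v, fun m => ?_, ?_⟩
  · have hpow : (basisGL b T).val ^ m = LinearMap.toMatrix b b (T.val ^ m) :=
      (LinearMap.toMatrix_pow b T.val m)
    rw [hpow]
    exact congrArg φ (happly _)
  · rw [← toMatrix_action]
    exact congrArg φ (happly _)

theorem IsCoeff.add (hx : IsCoeff α x) (hy : IsCoeff α y) : IsCoeff α (x + y) := by
  obtain ⟨n, A, φ, v, hx₁, hx₂⟩ := hx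
  obtain ⟨p, B, ψ, w, hy₁, hy₂⟩ := hy
  convert isCoeff_action α (prodEnd (endOfGL A) (endOfGL B)) (φ.coprod ψ) (v, w) using 1
  refine Prod.ext (funext fun m => ?_) ?_
  · simp only [prodEnd_pow_apply, endOfGL_pow_apply, LinearMap.coprod_apply, hx₁, hy₁, Prod.fst_add,
      Pi.add_apply]
  · simp only [action_prodEnd_apply, action_endOfGL_apply, LinearMap.coprod_apply, hx₂, hy₂,
      Prod.snd_add]

theorem IsCoeff.mul (hα : α ∈ AutTensor forgetR) (hx : IsCoeff α x) (hy : IsCoeff α y) :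
    IsCoeff α (x * y) := by
  obtain ⟨n, A, φ, v, hx₁, hx₂⟩ := hx
  obtain ⟨p, B, ψ, w, hy₁, hy₂⟩ := hy
  let χ : (Fin (n * p) → ℂ) →ₗ[ℂ] ℂ :=
    LinearMap.mul' ℂ ℂ ∘ₗ TensorProduct.map φ ψ ∘ₗ (tensorPi n p).symm.toLinearMap
  have hχ (M : Matrix (Fin n) (Fin n) ℂ) (N : Matrix (Fin p) (Fin p) ℂ) :
      χ ((kron M N).mulVec (tensorPi n p (TensorProduct.tmul ℂ v w))) =
        φ (M.mulVec v) * ψ (N.mulVec w) := by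
    rw [kron_mulVec]
    simp [χ]
  refine ⟨n * p, kronGL A B, χ, tensorPi n p (TensorProduct.tmul ℂ v w), fun m => ?_, ?_⟩
  · have hpow : (kronGL A B).val ^ m = kron (A.val ^ m) (B.val ^ m) := kron_pow A.val B.val m
    rw [hpow, hχ, hx₁, hy₁]
    rfl
  · have hcomp : compMat α ⟨n * p, kronGL A B⟩ = kron (compMat α ⟨n, A⟩) (compMat α ⟨p, B⟩) :=
      FlatSys.componentMat_tensor hα ⟨n, A⟩ ⟨p, B⟩
    rw [hcomp, hχ, hx₂, hy₂]
    rfl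

theorem IsCoeff.const (hα : α ∈ AutTensor forgetR) (c : ℂ) :
    IsCoeff α (algebraMap ℂ ((ℕ → ℂ) × ℂ) c) := by
  have hunit : compMat α ⟨1, 1⟩ = (1 : Matrix (Fin 1) (Fin 1) ℂ) := FlatSys.componentMat_unit hα
  refine ⟨1, 1, c • LinearMap.proj 0, 1, fun m => by simp, ?_⟩
  rw [hunit]
  simp

theorem IsCoeff.eq_zero {z : ℂ} (h : IsCoeff α (0, z)) : z = 0 := by
  obtain ⟨n, A, φ, v, hφ, hz⟩ := h
  set U : Submodule ℂ (Fin n → ℂ) := Submodule.span ℂ (Set.range fun m : ℕ => (A.val ^ m).mulVec v)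
  have hker : U ≤ LinearMap.ker φ := Submodule.span_le.mpr (Set.range_subset_iff.mpr hφ)
  have hinv : U ≤ U.comap (endOfGL A).val := by
    refine Submodule.span_le.mpr (Set.range_subset_iff.mpr fun m =>
      Submodule.subset_span ⟨m + 1, ?_⟩)
    exact (congrArg (·.mulVec v) (pow_succ' A.val m)).trans (Matrix.mulVec_mulVec v A.val _).symm
  have hv : v ∈ U := Submodule.subset_span ⟨0, by simp⟩
  have hαv : action α (endOfGL A) v ∈ U := action_mem hinv hv
  rw [action_endOfGL_apply] at hαv
  exact hz.symm.trans (hker hαv)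

/-- The algebra of matrix coefficients, paired with their values under a tensor automorphism. -/
def coeffAlgebra (hα : α ∈ AutTensor forgetR) : Subalgebra ℂ ((ℕ → ℂ) × ℂ) where
  carrier := {x | IsCoeff α x}
  mul_mem' hx hy := hx.mul hα hy
  add_mem' hx hy := hx.add hy
  algebraMap_mem' c := IsCoeff.const hα c

theorem coeffAlgebra_unique (hα : α ∈ AutTensor forgetR) {f : ℕ → ℂ} {z w : ℂ}
    (hz : (f, z) ∈ coeffAlgebra hα) (hw : (f, w) ∈ coeffAlgebra hα) : z = w := by
  have hsub := (coeffAlgebra hα).sub_mem hz hw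
  rw [Prod.mk_sub_mk, sub_self] at hsub
  exact sub_eq_zero.mp (IsCoeff.eq_zero hsub)

/-- The value of an automorphism of `ω` at the character `m ↦ cᵐ` of `ℤ`. -/
def rankOneValue (α : Aut forgetR) (c : ℂˣ) : ℂ :=
  (compMat α ⟨1, rankOneGL c⟩ : Matrix (Fin 1) (Fin 1) ℂ) 0 0

/-- The value of an automorphism of `ω` at the additive coefficient `m ↦ m` of the Jordan block. -/
def jordanValue (α : Aut forgetR) : ℂ :=
  (compMat α ⟨2, jordanTwo⟩ : Matrix (Fin 2) (Fin 2) ℂ) 0 1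

theorem rankOneValue_mem_coeffAlgebra (hα : α ∈ AutTensor forgetR) (c : ℂˣ) :
    (fun m => (c : ℂ) ^ m, rankOneValue α c) ∈ coeffAlgebra hα := by
  refine ⟨1, rankOneGL c, LinearMap.proj 0, Pi.single 0 1, fun m => ?_, ?_⟩
  · have hpow : (rankOneGL c).val ^ m = Matrix.scalar (Fin 1) ((c : ℂ) ^ m) :=
      (map_pow (Matrix.scalar (Fin 1)) (c : ℂ) m).symm
    rw [hpow]
    simp
  · simp [rankOneValue]

theorem jordanTwo_pow (m : ℕ) : jordanTwo.val ^ m = !![1, (m : ℂ); 0, 1] := by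
  induction m with
  | zero => simp [Matrix.one_fin_two]
  | succ m ih => rw [pow_succ, ih]; simp [jordanTwo, add_comm]

theorem jordanValue_mem_coeffAlgebra (hα : α ∈ AutTensor forgetR) :
    (fun m : ℕ => (m : ℂ), jordanValue α) ∈ coeffAlgebra hα := by
  refine ⟨2, jordanTwo, LinearMap.proj 0, Pi.single 1 1, fun m => ?_, ?_⟩
  · simp [jordanTwo_pow]
  · simp [jordanValue]

theorem choose_mem_coeffAlgebra (hα : α ∈ AutTensor forgetR) (k : ℕ) :
    (fun m : ℕ => (m.choose k : ℂ), Ring.choose (jordanValue α) k) ∈ coeffAlgebra hα := by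
  convert Algebra.adjoin_singleton_le (jordanValue_mem_coeffAlgebra hα)
    (aeval_mem_adjoin_singleton ℂ _ (p := choosePoly k)) using 1
  rw [aeval_prod_apply, aeval_pi_apply]
  simp only [coe_aeval_eq_eval, eval_choosePoly, Ring.choose_natCast]

theorem conjDiag_pow {n : ℕ} (Q : GL (Fin n) ℂ) (c : Fin n → ℂˣ) (m : ℕ) :
    conjDiag Q c ^ m = conjDiag Q (c ^ m) := by
  induction m with
  | zero => rw [pow_zero, pow_zero, conjDiag_one]
  | succ m ih => rw [pow_succ, ih, conjDiag_mul, pow_succ]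

theorem conjDiag_eq_sum {n : ℕ} (Q : GL (Fin n) ℂ) (c : Fin n → ℂˣ) :
    conjDiag Q c = ∑ i, (c i : ℂ) • (Q.val * Matrix.single i i 1 * Q⁻¹.val) := by
  rw [conjDiag, ← Matrix.sum_single_eq_diagonal, Matrix.mul_sum, Matrix.sum_mul]
  refine Finset.sum_congr rfl fun i _ => ?_
  rw [← Matrix.smul_mul, ← Matrix.mul_smul, Matrix.smul_single, smul_eq_mul, mul_one]

theorem exists_pow_eq_sum {n : ℕ} (A : GL (Fin n) ℂ) :
    ∃ (c : Fin n → ℂˣ) (E : Fin n → ℕ → Matrix (Fin n) (Fin n) ℂ), ∀ m : ℕ,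
      A.val ^ m = ∑ k ∈ Finset.range n, ∑ i, ((c i : ℂ) ^ m * m.choose k) • E i k := by
  obtain ⟨Q, c, U, hU, hQU, hA⟩ := exists_dunford A
  refine ⟨c, fun i k => Q.val * Matrix.single i i 1 * Q⁻¹.val * (U - 1) ^ k, fun m => ?_⟩
  rw [hA, hQU.mul_pow, conjDiag_pow, ← unipotentPow_natCast hU, conjDiag_eq_sum, unipotentPow,
    Matrix.mul_sum]
  refine Finset.sum_congr rfl fun k _ => ?_
  rw [Matrix.sum_mul]
  refine Finset.sum_congr rfl fun i _ => ?_
  simp [smul_smul, mul_comm, Ring.choose_natCast]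

theorem compMat_apply_eq_sum (hα : α ∈ AutTensor forgetR) {n : ℕ} {A : GL (Fin n) ℂ}
    {c : Fin n → ℂˣ} {E : Fin n → ℕ → Matrix (Fin n) (Fin n) ℂ}
    (hE : ∀ m : ℕ, A.val ^ m = ∑ k ∈ Finset.range n, ∑ i, ((c i : ℂ) ^ m * m.choose k) • E i k) :
    compMat α ⟨n, A⟩ = ∑ k ∈ Finset.range n, ∑ i,
      (rankOneValue α (c i) * Ring.choose (jordanValue α) k) • E i k := by
  refine Matrix.ext fun r s => ?_
  have hcoeff : (fun m => (A.val ^ m) r s, compMat α ⟨n, A⟩ r s) ∈ coeffAlgebra hα :=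
    ⟨n, A, LinearMap.proj r, Pi.single s 1, fun m => by simp, by simp⟩
  refine coeffAlgebra_unique hα hcoeff ?_
  convert (coeffAlgebra hα).sum_mem fun k (_ : k ∈ Finset.range n) =>
    (coeffAlgebra hα).sum_mem fun i (_ : i ∈ Finset.univ) =>
      (coeffAlgebra hα).smul_mem ((coeffAlgebra hα).mul_mem
        (rankOneValue_mem_coeffAlgebra hα (c i)) (choose_mem_coeffAlgebra hα k)) (E i k r s)
    using 1
  refine Prod.ext (funext fun m => ?_) ?_
  · simp [hE, Matrix.sum_apply, Prod.fst_sum, Finset.sum_apply, mul_comm]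
  · simp [Matrix.sum_apply, Prod.snd_sum, mul_comm]

theorem tensorAut_ext (hα : α ∈ AutTensor forgetR) (hβ : β ∈ AutTensor forgetR)
    (hrank : rankOneValue α = rankOneValue β) (hjordan : jordanValue α = jordanValue β) :
    α = β := by
  refine FlatSys.aut_ext fun ⟨n, A⟩ => ?_
  obtain ⟨c, E, hE⟩ := exists_pow_eq_sum A
  refine (compMat_apply_eq_sum hα hE).trans ?_
  rw [hrank, hjordan]
  exact (compMat_apply_eq_sum hβ hE).symm

/-- The character `γ` of `ℂ*` attached to a tensor automorphism. -/
def characterOf (hα : α ∈ AutTensor forgetR) : ℂˣ →* ℂˣ :=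
  MonoidHom.toHomUnits
    { toFun := rankOneValue α
      map_one' := by
        refine coeffAlgebra_unique hα (rankOneValue_mem_coeffAlgebra hα 1) ?_
        convert (coeffAlgebra hα).one_mem using 1
        simp [Prod.ext_iff, funext_iff]
      map_mul' := fun c d => by
        refine coeffAlgebra_unique hα (rankOneValue_mem_coeffAlgebra hα (c * d)) ?_
        convert (coeffAlgebra hα).mul_mem (rankOneValue_mem_coeffAlgebra hα c)
          (rankOneValue_mem_coeffAlgebra hα d) using 1
        simp [Prod.ext_iff, funext_iff, mul_pow] }

theorem zalgHom_surjective : Function.Surjective zalgHom := by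
  rintro ⟨α, hα⟩
  let g : Zalg := (characterOf hα, Multiplicative.ofAdd (jordanValue α))
  refine ⟨g, Subtype.ext (tensorAut_ext (zalgHom g).2 hα (funext fun c => ?_) ?_)⟩
  · exact (congrFun (congrFun (compMat_autOfZalg g ⟨1, rankOneGL c⟩) 0) 0).trans
      (incarnation_rankOneGL g c)
  · exact (congrFun (congrFun (compMat_autOfZalg g ⟨2, jordanTwo⟩) 0) 1).trans
      (incarnation_jordanTwo g)

/-- The isomorphism `ℤ^alg ≃ Aut^⊗(ω)`, `(γ,λ) ↦ ((ℂⁿ, A) ↦ A^{(γ,λ)})`. -/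
def zalgEquiv : Zalg ≃* AutTensor forgetR :=
  MulEquiv.ofBijective zalgHom ⟨zalgHom_injective, zalgHom_surjective⟩

end Coefficients

/-! ### The fibre functor `ω_{z₀}⁽⁰⁾` -/

section FibreAtPoint

variable {q : ℂˣ} {hq : 1 < ‖(q : ℂ)‖} {z₀ : ℂˣ} {g : Zalg}

theorem restrict_injective : Function.Injective (restrict q hq z₀) := by
  intro α β h
  refine Subtype.ext (Iso.ext ?_)
  ext X : 2
  exact congrArg (fun γ : AutTensor forgetR => γ.1.hom.app ⟨X.n, X.A⟩) h

theorem incarnation_intertwine_zpow (hg : g.1 q = 1) {n p : ℕ} {A : GL (Fin n) ℂ}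
    {B : GL (Fin p) ℂ} {k : ℤ} {F : Matrix (Fin p) (Fin n) ℂ}
    (hF : (q : ℂ) ^ k • (F * A.val) = B.val * F) :
    F * incarnation g A = incarnation g B * F := by
  let A' : GL (Fin n) ℂ := Units.map (Matrix.scalar (Fin n)).toMonoidHom (q ^ k) * A
  have hA' : A'.val = ((q ^ k : ℂˣ) : ℂ) • A.val := (Matrix.smul_eq_diagonal_mul A.val _).symm
  have hFA' : F * A'.val = B.val * F := by
    rw [hA', Matrix.mul_smul, Units.val_zpow_eq_zpow_val, hF]
  have hsmul : incarnation g A' = incarnation g A := by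
    rw [incarnation_smul _ hA', map_zpow, hg, one_zpow, Units.val_one, one_smul]
  exact hsmul ▸ incarnation_intertwine g hFA'

theorem evalSeries_morphism (hq : 1 < ‖(q : ℂ)‖) (z₀ : ℂˣ) {X Y : P0 q} (f : X ⟶ Y) :
    ∃ s : Finset ℤ, (f.F.map fun u : ConvLaurent => evalSeries z₀ u.1) =
      ∑ k ∈ s, (z₀ : ℂ) ^ k • f.F.map (coeffHom k) := by
  classical
  refine ⟨Finset.univ.biUnion fun i => Finset.univ.biUnion fun j =>
    (P0.entry_finite hq f i j).toFinset, Matrix.ext fun i j => ?_⟩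
  rw [Matrix.map_apply, Matrix.sum_apply, evalSeries, tsum_eq_sum]
  · exact Finset.sum_congr rfl fun k _ => mul_comm _ _
  · intro k hk
    simp only [Finset.mem_biUnion, Finset.mem_univ, true_and, not_exists,
      Set.Finite.mem_toFinset] at hk
    rw [not_not.mp (hk i j), zero_mul]

theorem incarnation_intertwine_eval (hq : 1 < ‖(q : ℂ)‖) (z₀ : ℂˣ) (hg : g.1 q = 1) {X Y : P0 q}
    (f : X ⟶ Y) :
    (f.F.map fun u : ConvLaurent => evalSeries z₀ u.1) * incarnation g X.A =
      incarnation g Y.A * f.F.map fun u : ConvLaurent => evalSeries z₀ u.1 := by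
  obtain ⟨s, hs⟩ := evalSeries_morphism hq z₀ f
  rw [hs, Matrix.sum_mul, Matrix.mul_sum]
  refine Finset.sum_congr rfl fun k _ => ?_
  rw [Matrix.smul_mul, Matrix.mul_smul, incarnation_intertwine_zpow hg (P0.coeff_comm f k)]

/-- The tensor automorphism `(ℂⁿ, A) ↦ A^{(γ,λ)}` of `ω_{z₀}⁽⁰⁾` attached to `(γ, λ)` with
`γ(q) = 1`. -/
def autOfLocal (hq : 1 < ‖(q : ℂ)‖) (z₀ : ℂˣ) (hg : g.1 q = 1) : AutTensor (omega q hq z₀) :=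
  FlatSys.tensorAutOfMatrices _ _ _ (fun X => incarnationGL g X.A)
    (fun _ _ f => incarnation_intertwine_eval hq z₀ hg f) (incarnation_one_right g)
    fun X Y => incarnation_kronGL g X.A Y.A

theorem restrict_autOfLocal (hg : g.1 q = 1) :
    restrict q hq z₀ (autOfLocal hq z₀ hg) = zalgEquiv g :=
  Subtype.ext (Iso.ext (by ext X : 2; rfl))

/-- The convergent Laurent series `z`. -/
def coordinate : ConvLaurent :=
  ⟨HahnSeries.single 1 1, 1, one_pos, SummableAt.of_finite
    ((Set.finite_singleton 1).subset HahnSeries.support_single_subset)⟩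

theorem sigmaQ_coordinate : sigmaQ q coordinate = algebraMap ℂ ConvLaurent q * coordinate := by
  ext k
  refine Eq.trans ?_ (coeffHom_const_mul k coordinate q).symm
  change (q : ℂ) ^ k * (HahnSeries.single (1 : ℤ) (1 : ℂ)).coeff k =
    q * (HahnSeries.single (1 : ℤ) (1 : ℂ)).coeff k
  obtain rfl | hk := eq_or_ne k 1
  · rw [zpow_one]
  · rw [HahnSeries.coeff_single_of_ne hk, mul_zero, mul_zero]

theorem evalSeries_coordinate (z : ℂˣ) : evalSeries z coordinate.1 = z := by
  change ∑' k : ℤ, (HahnSeries.single (1 : ℤ) (1 : ℂ)).coeff k * (z : ℂ) ^ k = z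
  rw [tsum_eq_single 1 fun k hk => by rw [HahnSeries.coeff_single_of_ne hk, zero_mul]]
  simp

/-- The morphism `z : (ℂ, 1) → (ℂ, q)` of `𝒫⁽⁰⁾`. -/
def coordinateHom (q : ℂˣ) : (⟨1, 1⟩ : P0 q) ⟶ ⟨1, rankOneGL q⟩ where
  F := (Matrix.of fun _ _ => coordinate : Matrix (Fin 1) (Fin 1) ConvLaurent)
  comm := by
    refine Matrix.ext (m := Fin 1) (n := Fin 1) fun i j => ?_
    rw [Subsingleton.elim i 0, Subsingleton.elim j 0]
    refine (Matrix.mul_apply (m := Fin 1)).trans (Eq.trans ?_ (Matrix.mul_apply (m := Fin 1)).symm)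
    rw [Fin.sum_univ_one, Fin.sum_univ_one]
    change sigmaQ q coordinate * algebraMap ℂ ConvLaurent ((1 : Matrix (Fin 1) (Fin 1) ℂ) 0 0) =
      algebraMap ℂ ConvLaurent ((rankOneGL q).val 0 0) * coordinate
    rw [Matrix.one_apply_eq, map_one, mul_one, rankOneGL_apply, sigmaQ_coordinate]

theorem apply_q_eq_one {α : AutTensor (omega q hq z₀)} (h : restrict q hq z₀ α = zalgEquiv g) :
    g.1 q = 1 := by
  have hα (A : GL (Fin 1) ℂ) :
      FlatSys.componentMat _ _ _ α.1 (⟨1, A⟩ : P0 q) = incarnation g A :=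
    (congrArg (fun β : AutTensor forgetR => compMat β.1 ⟨1, A⟩) h).trans
      (compMat_autOfZalg g ⟨1, A⟩)
  have hnat : (Matrix.of fun _ _ => evalSeries z₀ coordinate.1 : Matrix (Fin 1) (Fin 1) ℂ) *
        FlatSys.componentMat _ _ _ α.1 (⟨1, 1⟩ : P0 q) =
      FlatSys.componentMat _ _ _ α.1 (⟨1, rankOneGL q⟩ : P0 q) *
        (Matrix.of fun _ _ => evalSeries z₀ coordinate.1 : Matrix (Fin 1) (Fin 1) ℂ) :=
    FlatSys.evMat_mul_componentMat α.1 (coordinateHom q)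
  rw [hα, hα, incarnation_one_right, mul_one, evalSeries_coordinate] at hnat
  have hentry : (z₀ : ℂ) = g.1 q * z₀ := by
    simpa [Matrix.mul_apply, incarnation_rankOneGL] using congrFun (congrFun hnat 0) 0
  exact Units.ext (mul_right_cancel₀ z₀.ne_zero (by rw [← hentry, Units.val_one, one_mul]))

theorem range_restrict :
    (restrict q hq z₀).range = (localSubgroup q).map zalgEquiv.toMonoidHom := by
  ext β
  constructor
  · rintro ⟨α, rfl⟩
    obtain ⟨g, hg⟩ := zalgEquiv.surjective (restrict q hq z₀ α)
    exact ⟨g, apply_q_eq_one hg.symm, hg⟩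
  · rintro ⟨g, hg, rfl⟩
    exact ⟨autOfLocal hq z₀ hg, restrict_autOfLocal hg⟩

/-- The isomorphism `(χ, λ) ↦ (χ ∘ π, λ)` from `Hom(ℂ*/q^ℤ, ℂ*) × ℂ` onto the subgroup `γ(q) = 1`
of `ℤ^alg`. -/
def quotientEquiv (q : ℂˣ) :
    ((ℂˣ ⧸ Subgroup.zpowers q →* ℂˣ) × Multiplicative ℂ) ≃* localSubgroup q where
  toFun x := ⟨(x.1.comp (QuotientGroup.mk' (Subgroup.zpowers q)), x.2), by
    change x.1 (q : ℂˣ ⧸ Subgroup.zpowers q) = 1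
    rw [(QuotientGroup.eq_one_iff q).mpr (Subgroup.mem_zpowers q), map_one]⟩
  invFun g := (QuotientGroup.lift (Subgroup.zpowers q) g.1.1
    ((Subgroup.zpowers_le (H := g.1.1.ker)).mpr g.2), g.1.2)
  left_inv x := Prod.ext (QuotientGroup.monoidHom_ext _ rfl) rfl
  right_inv g := rfl
  map_mul' x y := rfl

/-- The isomorphism from `Hom(ℂ*/q^ℤ, ℂ*) × ℂ` to `Aut^⊗(ω_{z₀}⁽⁰⁾)`. -/
def quotientEquivAut (hq : 1 < ‖(q : ℂ)‖) (z₀ : ℂˣ) :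
    ((ℂˣ ⧸ Subgroup.zpowers q →* ℂˣ) × Multiplicative ℂ) ≃* AutTensor (omega q hq z₀) :=
  (quotientEquiv q).trans <| (zalgEquiv.subgroupMap (localSubgroup q)).trans <|
    (MulEquiv.subgroupCongr range_restrict.symm).trans
      (MonoidHom.ofInjective restrict_injective).symm

theorem restrict_quotientEquivAut (x : (ℂˣ ⧸ Subgroup.zpowers q →* ℂˣ) × Multiplicative ℂ) :
    restrict q hq z₀ (quotientEquivAut hq z₀ x) = zalgEquiv (quotientEquiv q x).1 :=
  MonoidHom.apply_ofInjective_symm restrict_injective _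

end FibreAtPoint

end QDiff

end

theorem mainTheorem2 (q : ℂˣ) (hq : 1 < ‖(q : ℂ)‖) (z₀ : ℂˣ) :
    ∃ e : QDiff.Zalg ≃* QDiff.AutTensor QDiff.forgetR,
      (∀ (g : QDiff.Zalg) (X : QDiff.RepZ) (M : Matrix (Fin X.n) (Fin X.n) ℂ),
        QDiff.compMat (e g).1 X = M ↔ QDiff.IsIncarnation g X.A M) ∧
      Function.Injective (QDiff.restrict q hq z₀) ∧
      (QDiff.restrict q hq z₀).range = (QDiff.localSubgroup q).map e.toMonoidHom ∧
      ∃ e' : ((ℂˣ ⧸ Subgroup.zpowers q →* ℂˣ) × Multiplicative ℂ) ≃*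
          QDiff.AutTensor (QDiff.omega q hq z₀),
        ∀ (χ : ℂˣ ⧸ Subgroup.zpowers q →* ℂˣ) (lam : Multiplicative ℂ),
          QDiff.restrict q hq z₀ (e' (χ, lam)) =
            e (χ.comp (QuotientGroup.mk' (Subgroup.zpowers q)), lam) := by
  refine ⟨QDiff.zalgEquiv, fun g X M => ?_, QDiff.restrict_injective, QDiff.range_restrict,
    QDiff.quotientEquivAut hq z₀, fun χ lam => QDiff.restrict_quotientEquivAut (χ, lam)⟩
  have hcomp : QDiff.compMat (QDiff.zalgEquiv g).1 X = QDiff.incarnation g X.A :=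
    QDiff.compMat_autOfZalg g X
  rw [hcomp, QDiff.incarnation_eq_iff]
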